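/- Let $H$ be a real separable Hilbert space and let $\mathbb T$ be $\mathbb Z$ or $\mathbb N\cup\{0\}$. On a probability space $(\Omega,\mathscr F,\mathbb P)$ let $(\xi_t)_{t\in\mathbb T}$ be a stationary process of centered random elements of $H$ with $\mathbb E\|\xi_t\|^2<\infty$ (it suffices that stationarity holds to second order). Two centered random elements $\xi,\eta$ of $H$ with finite second strong moments are called strongly orthogonal if $\mathbb E\langle h,\xi\rangle\langle f,\eta\rangle=0$ for all $h,f\in H$. Let $(\epsilon_t)_{t\in\mathbb T}$ be noise: $\mathbb E\|\epsilon_t\|^2<\infty$, $\mathbb E\epsilon_t=0$, and $\epsilon_t,\epsilon_s$ are strongly orthogonal for $t\ne s$ (the case $\epsilon_t=0$ is allowed). One observes $\zeta_t=\xi_t+\epsilon_t$. Put $R_k(h)=\mathbb E\langle\xi_0,h\rangle\xi_k$ for $h\in H$, $S=R_1R_1^*$ and $M=\overline{\operatorname{ran}(R_0)}$, and $$\widehat R_1(h)=\frac1{n-1}\sum_{t=1}^{n-1}\langle\zeta_t,h\rangle\zeta_{t+1},\qquad \widehat S=\widehat R_1\widehat R_1^*.$$ Let $(\theta_j)_{j\in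 J}$ be the non-increasing sequence of nonzero eigenvalues of $S$, repeated according to multiplicity, where $J=\{1,\dots,d\}$ if $S$ has finite rank $d$ and $J=\{1,2,\dots\}$ otherwise. Let $\widehat\theta_1\ge\widehat\theta_2\ge\cdots$ be the eigenvalues of $\widehat S$ (zero included), repeated according to multiplicity, with an associated orthonormal basis $\widehat\psi_1,\widehat\psi_2,\dots$ of $H$ consisting of eigenvectors of $\widehat S$. Put $N_j=\ker(S-\theta_j)$, $\widehat N_j=\ker(\widehat S-\widehat\theta_j)$ and $\widehat M_k=\operatorname{span}\{\widehat\psi_1,\dots,\widehat\psi_k\}$; let $\Pi_V$ be the orthogonal projection onto a closed subspace $V$, and $\|A\|_2=\big(\sum_i\|Ae_i\|^2\big)^{1/2}$, for an orthonormal basis $(e_i)$ of $H$, the Hilbert–Schmidt norm. Here $X_n=O_{\mathbb P}(a_n)$ means that for each $\varepsilon>0$ there are $C$ and $n_0$ with $\mathbb P(X_n>Ca_n)\le\varepsilon$ for all $n\ge n_0$; $X_n=\infty$ is allowed. Assume: (A1) $\overline{\operatorname{ran}(R_1)}=\overline{\operatorname{ran}(R_0)}$; (A2) $(\zeta_t)$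 is strictly stationary and $\psi$-mixing with $\sum_{k\ge1}k\,\psi^{1/2}(k)<\infty$, where $\psi(k)$ is the supremum of $\left|\frac{\mathbb P(A\cap B)}{\mathbb P(A)\mathbb P(B)}-1\right|$ over $t\in\mathbb T$, $A\in\sigma(\zeta_s:s\le t)$, $B\in\sigma(\zeta_s:s\ge t+k)$ with $\mathbb P(A)\mathbb P(B)>0$; (A3) $\mathbb E\|\zeta_t\|^4<\infty$ for all $t$; (A4) $\epsilon_t$ and $\xi_s$ are strongly orthogonal for all $t,s$. Then: (i) $\|\Pi_{\widehat N_j}-\Pi_{N_j}\|_2=O_{\mathbb P}(n^{-1/2})$ for every $j\in J$ such that $N_j$ is one-dimensional; (ii) if $S$ has rank $d<\infty$, then $\|\Pi_{\widehat M_d}-\Pi_M\|_2=O_{\mathbb P}(n^{-1/2})$; (iii) there is a metric $\rho$ on the set of finite-dimensional subspaces of $H$, depending only on $H$, such that, if $S$ has rank $d<\infty$, then $M$ is finite-dimensional and $\rho(\widehat M_d,M)=O_{\mathbb P}(n^{-1/2})$. -/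

import Mathlib

open MeasureTheory Filter Topology
open scoped ENNReal NNReal

namespace HilbertSeries

universe u v

/-! ### Hilbert-Schmidt norm -/

section HilbertSchmidt

variable {H : Type u} [NormedAddCommGroup H] [InnerProductSpace ℝ H] [CompleteSpace H]

/-- The number `(∑ i, ‖A (b i)‖²)^(1/2)` computed in the orthonormal basis `b`. -/
noncomputable def hsNormIn {ι : Type*} (b : HilbertBasis ι ℝ H) (A : H →L[ℝ] H) : ℝ≥0∞ :=
  (∑' i, ‖A (b i)‖ₑ ^ 2) ^ (1 / 2 : ℝ)

/-- The index set of some orthonormal basis of `H`. -/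
noncomputable def basisIndex (H : Type u) [NormedAddCommGroup H] [InnerProductSpace ℝ H]
    [CompleteSpace H] : Set H :=
  (exists_hilbertBasis ℝ H).choose

/-- Some orthonormal basis of `H`. -/
noncomputable def someBasis (H : Type u) [NormedAddCommGroup H] [InnerProductSpace ℝ H]
    [CompleteSpace H] : HilbertBasis (basisIndex H) ℝ H :=
  (exists_hilbertBasis ℝ H).choose_spec.choose

/-- The Hilbert-Schmidt norm `‖A‖₂` of a bounded operator; it is `∞` when `A` is not
Hilbert-Schmidt. By `hsNorm_eq` it may be computed in any orthonormal basis. -/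
noncomputable def hsNorm (A : H →L[ℝ] H) : ℝ≥0∞ := hsNormIn (someBasis H) A

theorem tsum_enorm_inner_sq {ι : Type*} (b : HilbertBasis ι ℝ H) (x : H) :
    ∑' i, ‖(inner ℝ (b i) x : ℝ)‖ₑ ^ 2 = ‖x‖ₑ ^ 2 := by
  have h := b.hasSum_inner_mul_inner x x
  have h2 : HasSum (fun i => ‖(inner ℝ (b i) x : ℝ)‖ ^ 2) (‖x‖ ^ 2) := by
    have h4 : (fun i => ‖(inner ℝ (b i) x : ℝ)‖ ^ 2) =
        fun i => (inner ℝ x (b i) : ℝ) * inner ℝ (b i) x := by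
      funext i
      rw [real_inner_comm (b i) x, Real.norm_eq_abs, sq_abs, sq]
    rwa [h4, ← real_inner_self_eq_norm_sq]
  have h3 : ∀ y : ℝ, ‖y‖ₑ ^ 2 = ENNReal.ofReal (‖y‖ ^ 2) := fun y => by
    rw [← ofReal_norm, ENNReal.ofReal_pow (norm_nonneg _)]
  simp_rw [h3]
  rw [← ENNReal.ofReal_tsum_of_nonneg (fun i => by positivity) h2.summable, h2.tsum_eq,
    ← ofReal_norm, ENNReal.ofReal_pow (norm_nonneg _)]

theorem tsum_enorm_sq_adjoint {ι κ : Type*} (b : HilbertBasis ι ℝ H) (c : HilbertBasis κ ℝ H)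
    (A : H →L[ℝ] H) :
    ∑' i, ‖A (b i)‖ₑ ^ 2 = ∑' j, ‖ContinuousLinearMap.adjoint A (c j)‖ₑ ^ 2 := by
  simp_rw [← tsum_enorm_inner_sq c (A _),
    ← tsum_enorm_inner_sq b (ContinuousLinearMap.adjoint A _)]
  rw [ENNReal.tsum_comm]
  refine tsum_congr fun j => tsum_congr fun i => ?_
  rw [ContinuousLinearMap.adjoint_inner_right, real_inner_comm]

/-- The Hilbert-Schmidt norm does not depend on the orthonormal basis. -/
theorem hsNorm_eq {ι : Type*} (b : HilbertBasis ι ℝ H) (A : H →L[ℝ] H) :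
    hsNorm A = hsNormIn b A := by
  unfold hsNorm hsNormIn
  rw [tsum_enorm_sq_adjoint (someBasis H) b A, ← tsum_enorm_sq_adjoint b b A]

end HilbertSchmidt

/-! ### Stochastic order -/

section Probability

variable {Ω : Type v} [MeasurableSpace Ω] {H : Type u} [NormedAddCommGroup H]
  [InnerProductSpace ℝ H]

/-- `X n = O_P(a n)`: for each `ε > 0` there is a constant `C` such that
`P(X n > C * a n) ≤ ε` for all sufficiently large `n`. The quantities `X n` may take the value
`∞`; for events that are not known to be measurable `P` is the outer probability. -/
def IsBigOInProb (P : Measure Ω) (X : ℕ → Ω → ℝ≥0∞) (a : ℕ → ℝ) : Prop :=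
  ∀ ε : ℝ≥0∞, 0 < ε → ∃ C : ℝ≥0, ∃ N : ℕ, ∀ n ≥ N,
    P {ω | ENNReal.ofReal ((C : ℝ) * a n) < X n ω} ≤ ε

/-! ### Random elements of a Hilbert space -/

/-- Strong orthogonality: `E ⟨h, ξ⟩ ⟨f, η⟩ = 0` for all `h`, `f`. -/
def StronglyOrthogonal (P : Measure Ω) (ξ η : Ω → H) : Prop :=
  ∀ h f : H, ∫ ω, (inner ℝ h (ξ ω) : ℝ) * inner ℝ f (η ω) ∂P = 0

/-- The cross-covariance operator `h ↦ E ⟨ξ, h⟩ η`, as the expectation of the random rank-one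
operator `h ↦ ⟨ξ, h⟩ η`. -/
noncomputable def crossCov (P : Measure Ω) (ξ η : Ω → H) : H →L[ℝ] H :=
  ∫ ω, InnerProductSpace.rankOne ℝ (η ω) (ξ ω) ∂P

/-- The defining formula of the cross-covariance operator. -/
theorem crossCov_apply [CompleteSpace H] {P : Measure Ω} {ξ η : Ω → H} (hξ : MemLp ξ 2 P)
    (hη : MemLp η 2 P) (h : H) :
    crossCov P ξ η h = ∫ ω, (inner ℝ (ξ ω) h : ℝ) • η ω ∂P := by
  have hc : Continuous fun p : H × H => InnerProductSpace.rankOne ℝ p.1 p.2 :=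
    ((InnerProductSpace.rankOne ℝ).continuous.comp continuous_fst).clm_apply continuous_snd
  have hm : AEStronglyMeasurable (fun ω => InnerProductSpace.rankOne ℝ (η ω) (ξ ω)) P :=
    Continuous.comp_aestronglyMeasurable (g := fun p : H × H => InnerProductSpace.rankOne ℝ p.1 p.2)
      (f := fun ω => (η ω, ξ ω)) hc (hη.1.prodMk hξ.1)
  have hint : Integrable (fun ω => InnerProductSpace.rankOne ℝ (η ω) (ξ ω)) P := by
    have hb : Integrable (fun ω => ‖η ω‖ * ‖ξ ω‖) P := hη.norm.integrable_mul hξ.norm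
    refine hb.mono' hm (Eventually.of_forall fun ω => ?_)
    rw [InnerProductSpace.norm_rankOne]
  unfold crossCov
  rw [ContinuousLinearMap.integral_apply hint]
  rfl

/-- Second-order stationarity on the set of times `𝕋`, with mean zero: each variable is a centered
random element of strong second order, and the cross-covariance operator of the variables at times
`s` and `t` depends on `t - s` only. -/
structure IsCenteredStationary (P : Measure Ω) [MeasurableSpace H] (𝕋 : Set ℤ)
    (ξ : ℤ → Ω → H) : Prop where
  measurable : ∀ t ∈ 𝕋, Measurable (ξ t)
  memLp : ∀ t ∈ 𝕋, MemLp (ξ t) 2 P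
  centered : ∀ t ∈ 𝕋, ∫ ω, ξ t ω ∂P = 0
  shift : ∀ s ∈ 𝕋, ∀ t ∈ 𝕋, ∀ k : ℕ,
    crossCov P (ξ (s + k)) (ξ (t + k)) = crossCov P (ξ s) (ξ t)

/-- Noise: centered random elements of strong second order which are mutually strongly orthogonal
at distinct times. -/
structure IsNoise (P : Measure Ω) [MeasurableSpace H] (𝕋 : Set ℤ) (e : ℤ → Ω → H) : Prop where
  measurable : ∀ t ∈ 𝕋, Measurable (e t)
  memLp : ∀ t ∈ 𝕋, MemLp (e t) 2 P
  centered : ∀ t ∈ 𝕋, ∫ ω, e t ω ∂P = 0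
  orthogonal : ∀ t ∈ 𝕋, ∀ s ∈ 𝕋, t ≠ s → StronglyOrthogonal P (e t) (e s)

/-- Strict stationarity on the set of times `𝕋`: the finite-dimensional distributions are
invariant under (forward) time shifts. -/
def IsStrictlyStationary (P : Measure Ω) [MeasurableSpace H] (𝕋 : Set ℤ) (X : ℤ → Ω → H) : Prop :=
  ∀ I : Finset ℤ, (I : Set ℤ) ⊆ 𝕋 → ∀ k : ℕ,
    P.map (fun ω (t : I) => X ((t : ℤ) + k) ω) = P.map (fun ω (t : I) => X (t : ℤ) ω)

/-! ### `ψ`-mixing -/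

/-- The `ψ`-dependence coefficient of two σ-algebras: the supremum of
`|P(A ∩ B) / (P(A) P(B)) - 1|` over `A ∈ 𝒜`, `B ∈ ℬ` with `P(A) > 0` and `P(B) > 0`. -/
noncomputable def psiDep (P : Measure Ω) (𝒜 ℬ : MeasurableSpace Ω) : ℝ≥0∞ :=
  ⨆ (A : Set Ω) (B : Set Ω) (_ : MeasurableSet[𝒜] A) (_ : MeasurableSet[ℬ] B)
    (_ : P A ≠ 0) (_ : P B ≠ 0),
    ENNReal.ofReal |P.real (A ∩ B) / (P.real A * P.real B) - 1|

/-- The σ-algebra generated by the variables `X t`, `t ∈ I`. -/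
abbrev sigmaOn [MeasurableSpace H] (X : ℤ → Ω → H) (I : Set ℤ) : MeasurableSpace Ω :=
  ⨆ t ∈ I, MeasurableSpace.comap (X t) inferInstance

/-- The `ψ`-mixing coefficients of a process: the supremum over `t ∈ 𝕋` of the coefficient between
the past up to time `t` and the future from time `t + k` on. -/
noncomputable def psiCoeff (P : Measure Ω) [MeasurableSpace H] (𝕋 : Set ℤ) (X : ℤ → Ω → H)
    (k : ℕ) : ℝ≥0∞ :=
  ⨆ t ∈ 𝕋, psiDep P (sigmaOn X {s | s ∈ 𝕋 ∧ s ≤ t}) (sigmaOn X {s | s ∈ 𝕋 ∧ t + k ≤ s})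

/-- `ψ`-mixing: the coefficients tend to zero. -/
def IsPsiMixing (P : Measure Ω) [MeasurableSpace H] (𝕋 : Set ℤ) (X : ℤ → Ω → H) : Prop :=
  Tendsto (psiCoeff P 𝕋 X) atTop (𝓝 0)

end Probability

/-! ### Eigenvalues, eigenvectors, eigenspaces -/

section Spectral

variable {H : Type u} [NormedAddCommGroup H] [InnerProductSpace ℝ H]

/-- The indices `1, 2, …, m`, or all positive integers if `m = ∞`. -/
def indices (m : ℕ∞) : Set ℕ := {j | 1 ≤ j ∧ (j : ℕ∞) ≤ m}

/-- The rank of an operator, `∞` if it is not finite. -/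
noncomputable def opRank (T : H →L[ℝ] H) : ℕ∞ :=
  Cardinal.toENat (LinearMap.rank (T : H →ₗ[ℝ] H))

/-- The eigenspace `ker (T - c)`. -/
def eigenker (T : H →L[ℝ] H) (c : ℝ) : Submodule ℝ H :=
  LinearMap.ker ((T - c • ContinuousLinearMap.id ℝ H : H →L[ℝ] H) : H →ₗ[ℝ] H)

instance [CompleteSpace H] (T : H →L[ℝ] H) (c : ℝ) : CompleteSpace (eigenker T c) :=
  ContinuousLinearMap.completeSpace_ker (T - c • ContinuousLinearMap.id ℝ H)

/-- A non-increasing family of eigenvalues `θ j`, `j ∈ J`, with an orthonormal family of associated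
eigenvectors `ψ j`. -/
structure IsOrderedEigensystem (T : H →L[ℝ] H) (J : Set ℕ) (θ : ℕ → ℝ) (ψ : ℕ → H) : Prop where
  antitone : AntitoneOn θ J
  orthonormal : Orthonormal ℝ (fun j : J => ψ j)
  apply_eq : ∀ j ∈ J, T (ψ j) = θ j • ψ j

/-- `θ j`, `j ∈ J`, is the non-increasing sequence of all nonzero eigenvalues of `T`, repeated
according to multiplicity, and the `ψ j` are associated orthonormal eigenvectors. Here
`J = {1, …, d}` if `T` has finite rank `d`, and `J = {1, 2, …}` otherwise. -/
structure IsNonzeroEigensystem (T : H →L[ℝ] H) (θ : ℕ → ℝ) (ψ : ℕ → H) : Prop extends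
    IsOrderedEigensystem T (indices (opRank T)) θ ψ where
  ne_zero : ∀ j ∈ indices (opRank T), θ j ≠ 0
  multiplicity : ∀ c : ℝ, c ≠ 0 →
    eigenker T c = Submodule.span ℝ (ψ '' {j | j ∈ indices (opRank T) ∧ θ j = c})

/-- `ψ 1, ψ 2, …` is an orthonormal basis of the (separable) space `H` consisting of eigenvectors
of `T`, and `θ 1 ≥ θ 2 ≥ …` is the non-increasing sequence of the associated eigenvalues, repeated
according to multiplicity (the eigenvalue zero included). The indices run through `1, …, dim H` if
`H` has finite dimension, and through all positive integers otherwise. -/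
structure IsEigenbasis (T : H →L[ℝ] H) (θ : ℕ → ℝ) (ψ : ℕ → H) : Prop extends
    IsOrderedEigensystem T (indices (Cardinal.toENat (Module.rank ℝ H))) θ ψ where
  dense : (Submodule.span ℝ
    (ψ '' indices (Cardinal.toENat (Module.rank ℝ H)))).topologicalClosure = ⊤

/-- The linear span of `ψ 1, …, ψ k`. -/
def leadingSpan (ψ : ℕ → H) (k : ℕ) : Submodule ℝ H := Submodule.span ℝ (ψ '' Set.Icc 1 k)

instance (ψ : ℕ → H) (k : ℕ) : FiniteDimensional ℝ (leadingSpan ψ k) :=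
  FiniteDimensional.span_of_finite ℝ ((Set.finite_Icc 1 k).image ψ)

/-- The closure of the range of an operator. -/
def closedRange (T : H →L[ℝ] H) : Submodule ℝ H :=
  (LinearMap.range (T : H →ₗ[ℝ] H)).topologicalClosure

instance [CompleteSpace H] (T : H →L[ℝ] H) : CompleteSpace (closedRange T) :=
  (Submodule.isClosed_topologicalClosure _).completeSpace_coe

end Spectral

/-! ### The model and the estimators -/

section Model

variable {Ω : Type v} [MeasurableSpace Ω] {H : Type u} [NormedAddCommGroup H]
  [InnerProductSpace ℝ H]

/-- The process `ζ = ξ + e` is observed: `ξ` is centered and stationary, `e` is noise, and the set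
of times is the set of all integers or the set of nonnegative integers. -/
structure IsNoisyMeasurement (P : Measure Ω) [MeasurableSpace H] (𝕋 : Set ℤ)
    (ξ e ζ : ℤ → Ω → H) : Prop where
  times : 𝕋 = Set.univ ∨ 𝕋 = {t | 0 ≤ t}
  signal : IsCenteredStationary P 𝕋 ξ
  noise : IsNoise P 𝕋 e
  observed : ∀ t ∈ 𝕋, ζ t = ξ t + e t

/-- The lag-`k` autocovariance operator `h ↦ E ⟨ξ 0, h⟩ ξ k`. -/
noncomputable def autocov (P : Measure Ω) (ξ : ℤ → Ω → H) (k : ℕ) : H →L[ℝ] H :=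
  crossCov P (ξ 0) (ξ k)

/-- The operator `S = R₁ R₁*`. -/
noncomputable def opS [CompleteSpace H] (P : Measure Ω) (ξ : ℤ → Ω → H) : H →L[ℝ] H :=
  autocov P ξ 1 ∘L ContinuousLinearMap.adjoint (autocov P ξ 1)

/-- The empirical lag-one autocovariance operator
`h ↦ (n - 1)⁻¹ ∑_{t=1}^{n-1} ⟨ζ t, h⟩ ζ (t + 1)`. -/
noncomputable def hatR (ζ : ℤ → Ω → H) (n : ℕ) (ω : Ω) : H →L[ℝ] H :=
  ((n : ℝ) - 1)⁻¹ • ∑ t ∈ Finset.Ico 1 n,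
    InnerProductSpace.rankOne ℝ (ζ ((t : ℤ) + 1) ω) (ζ (t : ℤ) ω)

/-- The estimator `Ŝ = R̂₁ R̂₁*`. -/
noncomputable def hatS [CompleteSpace H] (ζ : ℤ → Ω → H) (n : ℕ) (ω : Ω) : H →L[ℝ] H :=
  hatR ζ n ω ∘L ContinuousLinearMap.adjoint (hatR ζ n ω)

end Model

end HilbertSeries

namespace HilbertSeries

universe u v

/-! ### Weyl comparison of quadratic forms and a Hilbert–Schmidt Davis–Kahan bound. -/

section Perturbation

variable {H : Type u} [NormedAddCommGroup H] [InnerProductSpace ℝ H]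

/-! ### Quadratic forms of diagonal operators -/

/-! A deterministic perturbation bound is combined with a mean-square rate for the lag-one
autocovariance.

Deterministic part. `S` is compact, symmetric and nonnegative. If `‖Ŝ - S‖` is small compared with
the relevant spectral gap, Weyl's inequality (`eigenvalue_le_add`, `eigenvalue_le_add'`) keeps the
unwanted eigenvalues of `Ŝ` away from those selected in `S`. The Davis–Kahan bound
`hsNorm_starProjection_sub_le` then makes the Hilbert–Schmidt distance of the spectral projections
at most a constant times `‖Ŝ - S‖`. As `S` is quadratic in `R₁`, this is locally at most a constant
times `‖R̂₁ - R₁‖₂`.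

Stochastic part. Strong orthogonality removes the noise from the lag-one covariance, so each
coordinate of `R̂₁ - R₁` is a centered average of products of two consecutive observations. The
`ψ`-mixing covariance inequality bounds its variance by `1/n` times second moments of those
products. These moments are summable over pairs of basis vectors by Parseval, with total controlled
by `E‖ζ 0‖⁴`. Hence `E‖R̂₁ - R₁‖₂² ≤ L/n` (`exists_lintegral_hsNorm_sq_le`), and Markov's inequality
gives the rate (`isBigOInProb_of_lintegral_sq_le`).

Assumption (A1) enters only through the identification of `M` with the range of `S` when that range
is finite-dimensional. The metric in (iii) is the gap metric, dominated by the Hilbert–Schmidt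
distance in (ii). -/

theorem inner_apply_self_le {ι : Type*} (b : HilbertBasis ι ℝ H) {T : H →L[ℝ] H}
    (hT : (T : H →ₗ[ℝ] H).IsSymmetric) {l : ι → ℝ} (hl : ∀ i, T (b i) = l i • b i) {x : H} {β : ℝ}
    (h : ∀ i, l i ≤ β ∨ (inner ℝ (b i) x : ℝ) = 0) :
    (inner ℝ (T x) x : ℝ) ≤ β * ‖x‖ ^ 2 := by
  have h1 := b.hasSum_inner_mul_inner (T x) x
  have h2 := (b.hasSum_inner_mul_inner x x).mul_left β
  rw [real_inner_self_eq_norm_sq] at h2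
  refine hasSum_le (fun i => ?_) h1 h2
  have h3 : (inner ℝ (T x) (b i) : ℝ) = l i * inner ℝ (b i) x := by
    have := hT x (b i)
    simp only [ContinuousLinearMap.coe_coe] at this
    rw [this, hl, inner_smul_right, real_inner_comm]
  rw [h3, real_inner_comm (b i) x]
  rcases h i with h | h
  · nlinarith [mul_self_nonneg (inner ℝ (b i) x : ℝ)]
  · simp [h]

theorem le_inner_apply_self {ι : Type*} (b : HilbertBasis ι ℝ H) {T : H →L[ℝ] H}
    (hT : (T : H →ₗ[ℝ] H).IsSymmetric) {l : ι → ℝ} (hl : ∀ i, T (b i) = l i • b i) {x : H} {α : ℝ}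
    (h : ∀ i, α ≤ l i ∨ (inner ℝ (b i) x : ℝ) = 0) :
    α * ‖x‖ ^ 2 ≤ (inner ℝ (T x) x : ℝ) := by
  have hT' : ((-T : H →L[ℝ] H) : H →ₗ[ℝ] H).IsSymmetric := fun x y => by
    have := hT x y
    simp only [ContinuousLinearMap.coe_coe] at this
    simp [this]
  have := inner_apply_self_le b hT' (l := fun i => - l i) (fun i => by simp [hl]) (x := x)
    (β := -α) (fun i => by simpa using h i)
  simp only [neg_apply, inner_neg_left] at this
  linarith

/-- The comparison at the heart of Weyl's inequality: if the form of `A` is at least `a` on a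
subspace, and that of `B` is at most `b` on the orthogonal complement of fewer vectors than the
dimension of the subspace, then `a ≤ b + ‖A - B‖`. -/
theorem le_add_norm_sub_of_forms (A B : H →L[ℝ] H) (U : Submodule ℝ H) [FiniteDimensional ℝ U]
    (s : Finset ℕ) (v : ℕ → H) (hs : s.card < Module.finrank ℝ U) {a b : ℝ}
    (hA : ∀ x ∈ U, a * ‖x‖ ^ 2 ≤ (inner ℝ (A x) x : ℝ))
    (hB : ∀ x, (∀ i ∈ s, (inner ℝ (v i) x : ℝ) = 0) → (inner ℝ (B x) x : ℝ) ≤ b * ‖x‖ ^ 2) :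
    a ≤ b + ‖A - B‖ := by
  -- Since `U` has dimension larger than the number of constraints, it contains a nonzero vector
  -- orthogonal to all `v i`; both form bounds apply to it.
  let f : U →ₗ[ℝ] (s → ℝ) :=
    LinearMap.pi fun i => (innerSL ℝ (v i) : H →ₗ[ℝ] ℝ) ∘ₗ U.subtype
  have hf : LinearMap.ker f ≠ ⊥ := by
    apply LinearMap.ker_ne_bot_of_finrank_lt
    simpa using hs
  obtain ⟨x, hx, hx0⟩ := Submodule.exists_mem_ne_zero_of_ne_bot hf
  have hx1 : ∀ i ∈ s, (inner ℝ (v i) (x : H) : ℝ) = 0 := fun i hi => by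
    have := congrFun (LinearMap.mem_ker.mp hx) ⟨i, hi⟩
    simpa [f] using this
  have h1 := hA x x.2
  have h2 := hB x hx1
  have h3 : (inner ℝ ((A - B) (x : H)) (x : H) : ℝ) ≤ ‖A - B‖ * ‖(x : H)‖ ^ 2 := by
    refine (real_inner_le_norm _ _).trans ?_
    have := (A - B).le_opNorm (x : H)
    nlinarith [norm_nonneg (x : H)]
  rw [sub_apply, inner_sub_left] at h3
  have h4 : 0 < ‖(x : H)‖ ^ 2 := by
    have : (x : H) ≠ 0 := by simpa using hx0
    positivity
  nlinarith

/-! ### Hilbert-Schmidt norm and projections -/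

section HS

theorem norm_starProjection_sq_of_orthonormal {κ : Type*} [Fintype κ] {v : κ → H}
    (hv : Orthonormal ℝ v) (V : Submodule ℝ H) [V.HasOrthogonalProjection]
    (hV : V = Submodule.span ℝ (Set.range v)) (x : H) :
    ‖V.starProjection x‖ ^ 2 = ∑ j, (inner ℝ (v j) x : ℝ) ^ 2 := by
  have h : V.starProjection x = ∑ j, (inner ℝ (v j) x : ℝ) • v j := by
    refine Submodule.eq_starProjection_of_mem_of_inner_eq_zero ?_ ?_
    · rw [hV]
      exact Submodule.sum_mem _ fun j _ =>
        Submodule.smul_mem _ _ (Submodule.subset_span ⟨j, rfl⟩)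
    · intro w hw
      rw [hV] at hw
      induction hw using Submodule.span_induction with
      | mem w hw =>
        obtain ⟨j, rfl⟩ := hw
        rw [inner_sub_left, hv.inner_left_fintype, real_inner_comm]
        simp
      | zero => simp
      | add w z _ _ h1 h2 => rw [inner_add_right, h1, h2, add_zero]
      | smul a w _ h1 => rw [inner_smul_right, h1, mul_zero]
  rw [h, ← real_inner_self_eq_norm_sq, hv.inner_sum]
  simp [sq]

variable [CompleteSpace H]

theorem hsNorm_sq {ι : Type*} (b : HilbertBasis ι ℝ H) (A : H →L[ℝ] H) :
    hsNorm A ^ 2 = ∑' i, ‖A (b i)‖ₑ ^ 2 := by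
  rw [hsNorm_eq b, hsNormIn, ← ENNReal.rpow_natCast, ← ENNReal.rpow_mul]
  norm_num

/-- By Parseval `‖A x‖²` is the sum of the `⟨A* b i, x⟩²`; Cauchy–Schwarz is applied to each term.
-/
theorem enorm_le_hsNorm (A : H →L[ℝ] H) : ‖A‖ₑ ≤ hsNorm A := by
  by_cases htop : hsNorm A = ∞
  · simp [htop]
  have key : ∀ x, ‖A x‖ₑ ≤ hsNorm A * ‖x‖ₑ := fun x => by
    have : ‖A x‖ₑ ^ 2 ≤ (hsNorm A * ‖x‖ₑ) ^ 2 := by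
      rw [mul_pow, hsNorm_sq (someBasis H), tsum_enorm_sq_adjoint (someBasis H) (someBasis H),
        ← tsum_enorm_inner_sq (someBasis H), ← ENNReal.tsum_mul_right]
      refine ENNReal.tsum_le_tsum fun i => ?_
      rw [← mul_pow, ← ContinuousLinearMap.adjoint_inner_left]
      gcongr
      rw [← ofReal_norm, ← ofReal_norm, ← ofReal_norm, ← ENNReal.ofReal_mul (norm_nonneg _)]
      exact ENNReal.ofReal_le_ofReal (norm_inner_le_norm _ _)
    exact (ENNReal.pow_le_pow_left_iff two_ne_zero).mp this
  have : ‖A‖ ≤ (hsNorm A).toReal := by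
    refine A.opNorm_le_bound ENNReal.toReal_nonneg fun x => ?_
    have := ENNReal.toReal_mono (ENNReal.mul_ne_top htop enorm_ne_top) (key x)
    simpa using this
  rw [← ofReal_norm]
  exact ENNReal.ofReal_le_of_le_toReal this

/-- For projections `P`, `Q` of equal finite rank `k`, `‖P - Q‖₂² = 2k - 2 tr(PQ)`. Each summand on
the right is the squared distance of `v j` from `U`. -/
theorem hsNorm_starProjection_sub_sq {ι κ : Type*} [Fintype κ] (b : HilbertBasis ι ℝ H)
    (I : Finset ι) {v : κ → H} (hv : Orthonormal ℝ v) (hcard : I.card = Fintype.card κ)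
    (U V : Submodule ℝ H) [U.HasOrthogonalProjection] [V.HasOrthogonalProjection]
    (hU : U = Submodule.span ℝ (b '' I)) (hV : V = Submodule.span ℝ (Set.range v)) :
    hsNorm (U.starProjection - V.starProjection) ^ 2 =
      ENNReal.ofReal (2 * ∑ j, (1 - ∑ i ∈ I, (inner ℝ (b i) (v j) : ℝ) ^ 2)) := by
  classical
  have hin : ∀ i ∈ I, U.starProjection (b i) = b i := fun i hi =>
    Submodule.starProjection_eq_self_iff.mpr
      (hU ▸ Submodule.subset_span (Set.mem_image_of_mem _ hi))
  have hout : ∀ i ∉ I, U.starProjection (b i) = 0 := fun i hi => by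
    rw [Submodule.starProjection_apply_eq_zero_iff, hU, Submodule.mem_orthogonal]
    intro w hw
    induction hw using Submodule.span_induction with
    | mem w hw =>
      obtain ⟨j, hj, rfl⟩ := hw
      exact b.orthonormal.inner_eq_zero fun h => hi (h ▸ hj)
    | zero => simp
    | add w z _ _ h1 h2 => rw [inner_add_left, h1, h2, add_zero]
    | smul a w _ h1 => rw [inner_smul_left, h1, mul_zero]
  have hb : ∀ i, ‖b i‖ = 1 := b.orthonormal.norm_eq_one
  set a : ι → ℝ := fun i => ∑ j, (inner ℝ (b i) (v j) : ℝ) ^ 2 with ha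
  have hP : ∀ i, ‖V.starProjection (b i)‖ ^ 2 = a i := fun i => by
    rw [norm_starProjection_sq_of_orthonormal hv V hV]
    simp_rw [ha, real_inner_comm]
  -- For `i ∈ I` the value is `1 - a i`, written as `a i` plus a correction supported on the finite
  -- set `I`; the `a i` sum to the trace of the projection onto `V`.
  have hterm : ∀ i, ‖(U.starProjection - V.starProjection) (b i)‖ ^ 2 =
      a i + (if i ∈ I then 1 - 2 * a i else 0) := fun i => by
    rw [sub_apply]
    split_ifs with hi
    · rw [hin i hi, ← hP]
      have h1 := Submodule.norm_sq_eq_add_norm_sq_starProjection (b i) V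
      rw [Submodule.starProjection_orthogonal_val, hb] at h1
      linarith
    · rw [hout i hi, zero_sub, norm_neg, hP, add_zero]
  have hsum1 : HasSum a (Fintype.card κ : ℝ) := by
    have : (Fintype.card κ : ℝ) = ∑ _j : κ, (1 : ℝ) := by simp
    rw [this]
    refine hasSum_sum fun j _ => ?_
    have h := b.hasSum_inner_mul_inner (v j) (v j)
    rw [real_inner_self_eq_norm_sq, hv.norm_eq_one, one_pow] at h
    simpa only [real_inner_comm (v j), ← sq] using h
  have hsum2 : HasSum (fun i => if i ∈ I then 1 - 2 * a i else 0) (∑ i ∈ I, (1 - 2 * a i)) := by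
    have : HasSum (fun i => if i ∈ I then 1 - 2 * a i else 0) _ :=
      hasSum_sum_of_ne_finset_zero (s := I) (fun i hi => by simp [hi])
    convert this using 1
    exact Finset.sum_congr rfl fun i hi => by simp [hi]
  have hsum := hsum1.add hsum2
  rw [hsNorm_sq b]
  have h3 : ∀ i, ‖(U.starProjection - V.starProjection) (b i)‖ₑ ^ 2 =
      ENNReal.ofReal (a i + (if i ∈ I then 1 - 2 * a i else 0)) := fun i => by
    rw [← hterm, ← ofReal_norm, ENNReal.ofReal_pow (norm_nonneg _)]
  simp_rw [h3]
  rw [← ENNReal.ofReal_tsum_of_nonneg (fun i => by rw [← hterm]; positivity) hsum.summable,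
    hsum.tsum_eq]
  congr 1
  rw [Finset.sum_sub_distrib, Finset.sum_sub_distrib, ← Finset.mul_sum, Finset.sum_comm]
  simp only [Finset.sum_const, Finset.card_univ, hcard, nsmul_eq_mul]
  ring

/-- A Davis-Kahan bound: if the eigenvalues `l i`, `i ∉ I`, of `T'` have distance at least `g` from
the eigenvalues of `T` at `v j`, then the spectral projections are close. -/
theorem hsNorm_starProjection_sub_le {ι κ : Type*} [Fintype κ] (b : HilbertBasis ι ℝ H)
    (I : Finset ι) {v : κ → H} (hv : Orthonormal ℝ v) (hcard : I.card = Fintype.card κ)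
    (U V : Submodule ℝ H) [U.HasOrthogonalProjection] [V.HasOrthogonalProjection]
    (hU : U = Submodule.span ℝ (b '' I)) (hV : V = Submodule.span ℝ (Set.range v))
    {T T' : H →L[ℝ] H} (hT' : (T' : H →ₗ[ℝ] H).IsSymmetric)
    {l : ι → ℝ} (hl : ∀ i, T' (b i) = l i • b i)
    {m : κ → ℝ} (hm : ∀ j, T (v j) = m j • v j) {g : ℝ} (hg : 0 < g)
    (hgap : ∀ i ∉ I, ∀ j, g ≤ |l i - m j|) :
    hsNorm (U.starProjection - V.starProjection) ≤
      ENNReal.ofReal (Real.sqrt (2 * Fintype.card κ) / g * ‖T' - T‖) := by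
  classical
  have key : ∀ j, 1 - ∑ i ∈ I, (inner ℝ (b i) (v j) : ℝ) ^ 2 ≤ (‖T' - T‖ / g) ^ 2 := fun j => by
    have h1 := b.hasSum_inner_mul_inner (v j) (v j)
    rw [real_inner_self_eq_norm_sq, hv.norm_eq_one, one_pow] at h1
    have h2 : HasSum (fun i => if i ∈ I then (inner ℝ (b i) (v j) : ℝ) ^ 2 else 0) _ :=
      hasSum_sum_of_ne_finset_zero (s := I) (fun i hi => by simp [hi])
    have h3 := h1.sub h2
    have h4 := (b.hasSum_inner_mul_inner ((T' - T) (v j)) ((T' - T) (v j))).mul_left (g ^ 2)⁻¹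
    rw [real_inner_self_eq_norm_sq] at h4
    have h5 : ∑ i ∈ I, (if i ∈ I then (inner ℝ (b i) (v j) : ℝ) ^ 2 else 0) =
        ∑ i ∈ I, (inner ℝ (b i) (v j) : ℝ) ^ 2 := Finset.sum_congr rfl fun i hi => by simp [hi]
    rw [h5] at h3
    have h6 := hasSum_le (fun i => ?_) h3 h4
    · refine h6.trans ?_
      have h7 := (T' - T).le_opNorm (v j)
      rw [hv.norm_eq_one, mul_one] at h7
      rw [div_pow, div_eq_inv_mul]
      gcongr
    · rw [real_inner_comm (b i) (v j), real_inner_comm (b i) ((T' - T) (v j))]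
      -- Outside `I` the factor `l i - m j` has modulus at least `g`, so the coordinates of `v j`
      -- there are at most `1/g` times those of `(T' - T) (v j)`.
      have h8 : (inner ℝ (b i) ((T' - T) (v j)) : ℝ) = (l i - m j) * inner ℝ (b i) (v j) := by
        have := hT' (b i) (v j)
        simp only [ContinuousLinearMap.coe_coe] at this
        rw [sub_apply, inner_sub_right, ← this, hl, hm, inner_smul_left,
          inner_smul_right]
        simp [sub_mul]
      by_cases hi : i ∈ I
      · simp only [hi, if_true]
        rw [sq, sub_self]
        have := mul_self_nonneg (inner ℝ (b i) ((T' - T) (v j)) : ℝ)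
        positivity
      · simp only [hi, if_false, sub_zero]
        rw [h8, inv_mul_eq_div, le_div_iff₀ (by positivity)]
        have h9 : g ^ 2 ≤ (l i - m j) ^ 2 := by
          rw [← sq_abs (l i - m j)]
          have := hgap i hi j
          gcongr
        nlinarith [mul_self_nonneg (inner ℝ (b i) (v j) : ℝ)]
  have h := hsNorm_starProjection_sub_sq b I hv hcard U V hU hV
  refine (ENNReal.pow_le_pow_left_iff two_ne_zero).mp ?_
  rw [h, ← ENNReal.ofReal_pow (by positivity)]
  refine ENNReal.ofReal_le_ofReal ?_
  calc 2 * ∑ j, (1 - ∑ i ∈ I, (inner ℝ (b i) (v j) : ℝ) ^ 2)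
      ≤ 2 * ∑ _j : κ, (‖T' - T‖ / g) ^ 2 := by
        gcongr with j
        exact key j
    _ = _ := by
        rw [mul_pow, div_pow, div_pow, Real.sq_sqrt (by positivity), Finset.sum_const,
          Finset.card_univ, nsmul_eq_mul]
        field_simp

end HS

end Perturbation

/-! ### Eigensystems of compact symmetric operators and their perturbation. -/

section Eigensystems

variable {H : Type u} [NormedAddCommGroup H] [InnerProductSpace ℝ H]

theorem mem_indices_of_le {m : ℕ∞} {i j : ℕ} (hj : j ∈ indices m) (hi : 1 ≤ i) (hij : i ≤ j) :
    i ∈ indices m :=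
  ⟨hi, le_trans (by exact_mod_cast hij) hj.2⟩

theorem Icc_subset_indices {m : ℕ∞} {j : ℕ} (hj : j ∈ indices m) :
    Set.Icc 1 j ⊆ indices m := fun _ hi => mem_indices_of_le hj hi.1 hi.2

theorem indices_opRank_subset (T : H →L[ℝ] H) :
    indices (opRank T) ⊆ indices (Cardinal.toENat (Module.rank ℝ H)) := fun _ hj =>
  ⟨hj.1, hj.2.trans (Cardinal.toENat.monotone' (LinearMap.rank_le_range _))⟩

theorem eigenker_mem {T : H →L[ℝ] H} {c : ℝ} {x : H} : x ∈ eigenker T c ↔ T x = c • x := by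
  simp [eigenker, sub_eq_zero]

namespace IsOrderedEigensystem

variable {T : H →L[ℝ] H} {J : Set ℕ} {θ : ℕ → ℝ} {ψ : ℕ → H}

theorem inner_eq_zero (h : IsOrderedEigensystem T J θ ψ) {i j : ℕ} (hi : i ∈ J) (hj : j ∈ J)
    (hij : i ≠ j) : (inner ℝ (ψ i) (ψ j) : ℝ) = 0 :=
  h.orthonormal.inner_eq_zero (i := ⟨i, hi⟩) (j := ⟨j, hj⟩) (by simpa using hij)

theorem norm_eq_one (h : IsOrderedEigensystem T J θ ψ) {i : ℕ} (hi : i ∈ J) : ‖ψ i‖ = 1 :=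
  h.orthonormal.norm_eq_one ⟨i, hi⟩

theorem inner_eq_zero_of_mem_leadingSpan (h : IsOrderedEigensystem T J θ ψ) {k i : ℕ}
    (hk : Set.Icc 1 k ⊆ J) (hi : i ∈ J) (hki : k < i) {x : H} (hx : x ∈ leadingSpan ψ k) :
    (inner ℝ (ψ i) x : ℝ) = 0 := by
  unfold leadingSpan at hx
  induction hx using Submodule.span_induction with
  | mem w hw =>
    obtain ⟨j, hj, rfl⟩ := hw
    exact h.inner_eq_zero hi (hk hj) (hj.2.trans_lt hki).ne'
  | zero => simp
  | add w z _ _ h1 h2 => rw [inner_add_right, h1, h2, add_zero]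
  | smul a w _ h1 => rw [inner_smul_right, h1, mul_zero]

theorem orthonormal_Icc (h : IsOrderedEigensystem T J θ ψ) {k : ℕ} (hk : Set.Icc 1 k ⊆ J) :
    Orthonormal ℝ (fun j : Set.Icc 1 k => ψ j) :=
  h.orthonormal.comp (fun j : Set.Icc 1 k => (⟨j, hk j.2⟩ : J))
    (fun a b hab => by simpa [Subtype.ext_iff] using hab)

theorem leadingSpan_eq (ψ : ℕ → H) (k : ℕ) :
    leadingSpan ψ k = Submodule.span ℝ (Set.range fun j : Set.Icc 1 k => ψ j) := by
  rw [leadingSpan, Set.image_eq_range]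

theorem finrank_leadingSpan (h : IsOrderedEigensystem T J θ ψ) {k : ℕ} (hk : Set.Icc 1 k ⊆ J) :
    Module.finrank ℝ (leadingSpan ψ k) = k := by
  rw [leadingSpan_eq, finrank_span_eq_card (h.orthonormal_Icc hk).linearIndependent]
  simp

end IsOrderedEigensystem

namespace IsEigenbasis

variable {T : H →L[ℝ] H} {θ : ℕ → ℝ} {ψ : ℕ → H}

variable [CompleteSpace H]

/-- The Hilbert basis of eigenvectors. -/
noncomputable def hilbertBasis (h : IsEigenbasis T θ ψ) :
    HilbertBasis (indices (Cardinal.toENat (Module.rank ℝ H))) ℝ H :=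
  HilbertBasis.mk h.orthonormal (by rw [← Set.image_eq_range, h.dense])

theorem hilbertBasis_apply (h : IsEigenbasis T θ ψ)
    (i : indices (Cardinal.toENat (Module.rank ℝ H))) : h.hilbertBasis i = ψ i := by
  simp [hilbertBasis]

theorem apply_hilbertBasis (h : IsEigenbasis T θ ψ)
    (i : indices (Cardinal.toENat (Module.rank ℝ H))) :
    T (h.hilbertBasis i) = θ i • h.hilbertBasis i := by
  rw [h.hilbertBasis_apply, h.apply_eq i i.2]

/-- On the orthogonal complement of the first `k - 1` eigenvectors the form is at most `θ k`. -/
theorem inner_apply_self_le (h : IsEigenbasis T θ ψ) (hT : (T : H →ₗ[ℝ] H).IsSymmetric) {k : ℕ}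
    (hk : k ∈ indices (Cardinal.toENat (Module.rank ℝ H))) {x : H}
    (hx : ∀ i ∈ Finset.Ico 1 k, (inner ℝ (ψ i) x : ℝ) = 0) :
    (inner ℝ (T x) x : ℝ) ≤ θ k * ‖x‖ ^ 2 := by
  refine HilbertSeries.inner_apply_self_le h.hilbertBasis hT (l := fun i => θ i)
    h.apply_hilbertBasis fun i => ?_
  rw [h.hilbertBasis_apply]
  rcases lt_or_ge (i : ℕ) k with hik | hik
  · exact Or.inr (hx i (Finset.mem_Ico.mpr ⟨i.2.1, hik⟩))
  · exact Or.inl (h.antitone hk i.2 hik)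

/-- On the span of the first `k` eigenvectors the form is at least `θ k`. -/
theorem le_inner_apply_self (h : IsEigenbasis T θ ψ) (hT : (T : H →ₗ[ℝ] H).IsSymmetric) {k : ℕ}
    (hk : k ∈ indices (Cardinal.toENat (Module.rank ℝ H))) {x : H} (hx : x ∈ leadingSpan ψ k) :
    θ k * ‖x‖ ^ 2 ≤ (inner ℝ (T x) x : ℝ) := by
  refine HilbertSeries.le_inner_apply_self h.hilbertBasis hT (l := fun i => θ i)
    h.apply_hilbertBasis fun i => ?_
  rw [h.hilbertBasis_apply]
  rcases lt_or_ge k (i : ℕ) with hik | hik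
  · exact Or.inr (h.inner_eq_zero_of_mem_leadingSpan (Icc_subset_indices hk) i.2 hik hx)
  · exact Or.inl (h.antitone i.2 hk hik)

/-- The eigenspace of a simple eigenvalue is spanned by its eigenvector. -/
theorem eigenker_eq (h : IsEigenbasis T θ ψ) (hT : (T : H →ₗ[ℝ] H).IsSymmetric) {j : ℕ}
    (hj : j ∈ indices (Cardinal.toENat (Module.rank ℝ H)))
    (hsimple : ∀ i ∈ indices (Cardinal.toENat (Module.rank ℝ H)), i ≠ j → θ i ≠ θ j) :
    eigenker T (θ j) = Submodule.span ℝ {ψ j} := by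
  refine le_antisymm (fun x hx => ?_) ?_
  · rw [eigenker_mem] at hx
    have hsum := h.hilbertBasis.hasSum_repr x
    have hz : ∀ i : indices (Cardinal.toENat (Module.rank ℝ H)), i ≠ ⟨j, hj⟩ →
        h.hilbertBasis.repr x i • h.hilbertBasis i = 0 := fun i hi => by
      rw [h.hilbertBasis.repr_apply_apply, h.hilbertBasis_apply]
      have h1 := hT (ψ i) x
      simp only [ContinuousLinearMap.coe_coe] at h1
      rw [h.apply_eq i i.2, hx, inner_smul_left, inner_smul_right] at h1
      have h2 : (θ i - θ j) * inner ℝ (ψ i) x = 0 := by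
        simp only [conj_trivial] at h1
        linarith
      rcases mul_eq_zero.mp h2 with h3 | h3
      · exact absurd (sub_eq_zero.mp h3)
          (hsimple i i.2 fun h4 => hi (Subtype.ext h4))
      · rw [h3, zero_smul]
    have := (hasSum_single _ hz).unique hsum
    rw [← this, h.hilbertBasis_apply]
    exact Submodule.smul_mem _ _ (Submodule.mem_span_singleton_self _)
  · rw [Submodule.span_singleton_le_iff_mem, eigenker_mem]
    exact h.apply_eq j hj

end IsEigenbasis

namespace IsNonzeroEigensystem

variable {T : H →L[ℝ] H} {θ : ℕ → ℝ} {ψ : ℕ → H}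

theorem pos (h : IsNonzeroEigensystem T θ ψ) (hpos : ∀ x, 0 ≤ (inner ℝ (T x) x : ℝ)) {j : ℕ}
    (hj : j ∈ indices (opRank T)) : 0 < θ j := by
  have h1 := hpos (ψ j)
  rw [h.apply_eq j hj, inner_smul_left, real_inner_self_eq_norm_sq, h.norm_eq_one hj] at h1
  exact lt_of_le_of_ne (by simpa using h1) (h.ne_zero j hj).symm

/-- Two distinct members of the orthonormal family cannot lie on one line. -/
theorem eq_of_finrank_eq_one (h : IsNonzeroEigensystem T θ ψ) {i j : ℕ}
    (hi : i ∈ indices (opRank T)) (hj : j ∈ indices (opRank T))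
    (hone : Module.finrank ℝ (eigenker T (θ j)) = 1) (hθ : θ i = θ j) : i = j := by
  by_contra hij
  have hψ : ∀ k ∈ indices (opRank T), θ k = θ j → ψ k ∈ eigenker T (θ j) := fun k hk hkj =>
    eigenker_mem.mpr (hkj ▸ h.apply_eq k hk)
  have hne : (⟨ψ j, hψ j hj rfl⟩ : eigenker T (θ j)) ≠ 0 := fun h0 => by
    have h1 := h.norm_eq_one hj
    have h2 : ψ j = 0 := by simpa using h0
    simp [h2] at h1
  obtain ⟨c, hc⟩ := (finrank_eq_one_iff_of_nonzero' _ hne).mp hone ⟨ψ i, hψ i hi hθ⟩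
  have hc' : c • ψ j = ψ i := by simpa using congrArg Subtype.val hc
  have h1 := h.inner_eq_zero hi hj hij
  rw [← hc', inner_smul_left, real_inner_self_eq_norm_sq, h.norm_eq_one hj] at h1
  have h2 := h.norm_eq_one hi
  rw [← hc'] at h2
  simp at h1
  simp [h1] at h2

/-- Each `ψ j` is the image of `(θ j)⁻¹ • ψ j`, and both spaces have dimension `d`. -/
theorem leadingSpan_eq_range (h : IsNonzeroEigensystem T θ ψ) {d : ℕ} (hd : opRank T = d) :
    leadingSpan ψ d = LinearMap.range (T : H →ₗ[ℝ] H) := by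
  have hJ : Set.Icc 1 d ⊆ indices (opRank T) := fun i hi =>
    ⟨hi.1, by rw [hd]; exact_mod_cast hi.2⟩
  have hrank : Module.rank ℝ (LinearMap.range (T : H →ₗ[ℝ] H)) = d := by
    have : Cardinal.toENat (LinearMap.rank (T : H →ₗ[ℝ] H)) = d := hd
    simpa using this
  have : FiniteDimensional ℝ (LinearMap.range (T : H →ₗ[ℝ] H)) :=
    Module.rank_lt_aleph0_iff.mp (hrank ▸ Cardinal.natCast_lt_aleph0)
  refine Submodule.eq_of_le_of_finrank_eq ?_ ?_
  · refine Submodule.span_le.mpr ?_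
    rintro _ ⟨j, hj, rfl⟩
    refine ⟨(θ j)⁻¹ • ψ j, ?_⟩
    simp [h.apply_eq j (hJ hj), smul_smul, h.ne_zero j (hJ hj)]
  · rw [h.finrank_leadingSpan hJ, Module.finrank_eq_of_rank_eq hrank]

variable [CompleteSpace H]

/-- If `T w = c w` then `⟨w, T z⟩ = c ⟨w, z⟩`, which vanishes either because `c = 0` or because `w`
lies in the span of the `ψ j`. So `T z` is orthogonal to all eigenvectors, and the spectral theorem
for compact symmetric operators leaves only zero. -/
theorem apply_eq_zero_of_orthogonal (h : IsNonzeroEigensystem T θ ψ)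
    (hT : (T : H →ₗ[ℝ] H).IsSymmetric) (hc : IsCompactOperator T) {z : H}
    (hz : ∀ j ∈ indices (opRank T), (inner ℝ (ψ j) z : ℝ) = 0) : T z = 0 := by
  have hmem : T z ∈ (⨆ μ, Module.End.eigenspace (T : Module.End ℝ H) μ)ᗮ := by
    rw [← Submodule.iInf_orthogonal, Submodule.mem_iInf]
    intro c
    rw [Submodule.mem_orthogonal]
    intro w hw
    rw [Module.End.mem_eigenspace_iff] at hw
    have h1 := hT w z
    rw [hw] at h1
    simp only [ContinuousLinearMap.coe_coe] at h1
    rw [← h1, inner_smul_left]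
    rcases eq_or_ne c 0 with rfl | hc0
    · simp
    · have hw' : w ∈ eigenker T c := eigenker_mem.mpr hw
      rw [h.multiplicity c hc0] at hw'
      have : (inner ℝ w z : ℝ) = 0 := by
        clear hw h1
        induction hw' using Submodule.span_induction with
        | mem w hw =>
          obtain ⟨j, hj, rfl⟩ := hw
          exact hz j hj.1
        | zero => simp
        | add w z _ _ h1 h2 => rw [inner_add_left, h1, h2, add_zero]
        | smul a w _ h1 => rw [inner_smul_left, h1, mul_zero]
      simp [this]
  rw [ContinuousLinearMap.orthogonalComplement_iSup_eigenspaces_eq_bot hc hT] at hmem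
  simpa using hmem

/-- The eigenvectors for the nonzero eigenvalues are completed to a Hilbert basis by elements of
the kernel. -/
theorem exists_hilbertBasis (h : IsNonzeroEigensystem T θ ψ)
    (hT : (T : H →ₗ[ℝ] H).IsSymmetric) (hc : IsCompactOperator T) :
    ∃ (w : Set H) (b : HilbertBasis w ℝ H) (l : w → ℝ), (∀ i, T (b i) = l i • b i) ∧
      ∀ i, (∃ j ∈ indices (opRank T), b i = ψ j ∧ l i = θ j) ∨
        (l i = 0 ∧ ∀ j ∈ indices (opRank T), (inner ℝ (b i) (ψ j) : ℝ) = 0) := by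
  classical
  have hon : Orthonormal ℝ
      ((↑) : Set.range (fun j : indices (opRank T) => ψ j) → H) := h.orthonormal.toSubtypeRange
  obtain ⟨w, b, hw, hb⟩ := hon.exists_hilbertBasis_extension
  have hex : ∀ i : w, ∃ l : ℝ, T (b i) = l • b i ∧
      ((∃ j ∈ indices (opRank T), b i = ψ j ∧ l = θ j) ∨
        (l = 0 ∧ ∀ j ∈ indices (opRank T), (inner ℝ (b i) (ψ j) : ℝ) = 0)) := fun i => by
    by_cases hi : (i : H) ∈ Set.range (fun j : indices (opRank T) => ψ j)
    · obtain ⟨j, hj⟩ := hi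
      have hij : b i = ψ j := by rw [hb]; exact hj.symm
      exact ⟨θ j, by rw [hij, h.apply_eq j j.2], Or.inl ⟨j, j.2, hij, rfl⟩⟩
    · have hz : ∀ j ∈ indices (opRank T), (inner ℝ (b i) (ψ j) : ℝ) = 0 := fun j hj => by
        have hjw : ψ j ∈ w := hw ⟨⟨j, hj⟩, rfl⟩
        have hbj : b ⟨ψ j, hjw⟩ = ψ j := by rw [hb]
        rw [← hbj]
        refine b.orthonormal.inner_eq_zero fun hij => hi ?_
        exact ⟨⟨j, hj⟩, (congrArg Subtype.val hij).symm⟩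
      refine ⟨0, ?_, Or.inr ⟨rfl, hz⟩⟩
      rw [zero_smul]
      exact h.apply_eq_zero_of_orthogonal hT hc fun j hj => by rw [real_inner_comm]; exact hz j hj
  choose l hl using hex
  exact ⟨w, b, l, fun i => (hl i).1, fun i => (hl i).2⟩

/-- The form on the orthogonal complement of the first `k` eigenvectors. -/
theorem inner_apply_self_le (h : IsNonzeroEigensystem T θ ψ) (hT : (T : H →ₗ[ℝ] H).IsSymmetric)
    (hc : IsCompactOperator T) {k : ℕ} {β : ℝ} (hβ : 0 ≤ β)
    (hθ : ∀ i ∈ indices (opRank T), k < i → θ i ≤ β) {x : H}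
    (hx : ∀ i ∈ Finset.Icc 1 k, (inner ℝ (ψ i) x : ℝ) = 0) :
    (inner ℝ (T x) x : ℝ) ≤ β * ‖x‖ ^ 2 := by
  obtain ⟨w, b, l, hl, hcase⟩ := h.exists_hilbertBasis hT hc
  refine HilbertSeries.inner_apply_self_le b hT hl fun i => ?_
  rcases hcase i with ⟨j, hj, hij, hlj⟩ | ⟨h0, -⟩
  · rcases lt_or_ge k j with hkj | hkj
    · exact Or.inl (hlj ▸ hθ j hj hkj)
    · exact Or.inr (hij ▸ hx j (Finset.mem_Icc.mpr ⟨hj.1, hkj⟩))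
  -- Basis vectors in the kernel contribute the eigenvalue zero, whence the requirement `0 ≤ β`.
  · exact Or.inl (h0 ▸ hβ)

/-- The form on the span of the first `k` eigenvectors. -/
theorem le_inner_apply_self (h : IsNonzeroEigensystem T θ ψ) (hT : (T : H →ₗ[ℝ] H).IsSymmetric)
    (hc : IsCompactOperator T) {k : ℕ} (hk : k ∈ indices (opRank T)) {x : H}
    (hx : x ∈ leadingSpan ψ k) : θ k * ‖x‖ ^ 2 ≤ (inner ℝ (T x) x : ℝ) := by
  obtain ⟨w, b, l, hl, hcase⟩ := h.exists_hilbertBasis hT hc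
  refine HilbertSeries.le_inner_apply_self b hT hl fun i => ?_
  rcases hcase i with ⟨j, hj, hij, hlj⟩ | ⟨-, h0⟩
  · rcases lt_or_ge k j with hkj | hkj
    · exact Or.inr (hij ▸ h.inner_eq_zero_of_mem_leadingSpan (Icc_subset_indices hk) hj hkj hx)
    · exact Or.inl (hlj ▸ h.antitone hj hk hkj)
  · right
    unfold leadingSpan at hx
    induction hx using Submodule.span_induction with
    | mem v hv =>
      obtain ⟨j, hj, rfl⟩ := hv
      exact h0 j (Icc_subset_indices hk hj)
    | zero => simp
    | add v z _ _ h1 h2 => rw [inner_add_right, h1, h2, add_zero]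
    | smul a v _ h1 => rw [inner_smul_right, h1, mul_zero]

variable {T' : H →L[ℝ] H} {θ' : ℕ → ℝ} {ψ' : ℕ → H}

/-- Upper half of Weyl's inequality. A bound `β` replaces the eigenvalue of index `k + 1`, which
need not exist among the nonzero ones; `β = 0` is then admissible. -/
theorem eigenvalue_le_add (h : IsNonzeroEigensystem T θ ψ) (hT : (T : H →ₗ[ℝ] H).IsSymmetric)
    (hc : IsCompactOperator T) (h' : IsEigenbasis T' θ' ψ') (hT' : (T' : H →ₗ[ℝ] H).IsSymmetric)
    {i k : ℕ} (hi : i ∈ indices (Cardinal.toENat (Module.rank ℝ H))) (hki : k < i) {β : ℝ}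
    (hβ : 0 ≤ β) (hθ : ∀ l ∈ indices (opRank T), k < l → θ l ≤ β) : θ' i ≤ β + ‖T' - T‖ := by
  refine le_add_norm_sub_of_forms T' T (leadingSpan ψ' i) (Finset.Icc 1 k) ψ ?_
    (fun x hx => h'.le_inner_apply_self hT' hi hx)
    (fun x hx => h.inner_apply_self_le hT hc hβ hθ hx)
  rw [h'.finrank_leadingSpan (Icc_subset_indices hi)]
  simpa using hki

theorem eigenvalue_le_add' (h : IsNonzeroEigensystem T θ ψ) (hT : (T : H →ₗ[ℝ] H).IsSymmetric)
    (hc : IsCompactOperator T) (h' : IsEigenbasis T' θ' ψ') (hT' : (T' : H →ₗ[ℝ] H).IsSymmetric)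
    {i : ℕ} (hi : i ∈ indices (opRank T)) : θ i ≤ θ' i + ‖T' - T‖ := by
  rw [norm_sub_rev]
  refine le_add_norm_sub_of_forms T T' (leadingSpan ψ i) (Finset.Ico 1 i) ψ' ?_
    (fun x hx => h.le_inner_apply_self hT hc hi hx)
    (fun x hx => h'.inner_apply_self_le hT' (indices_opRank_subset T hi) hx)
  rw [h.finrank_leadingSpan (Icc_subset_indices hi)]
  have := hi.1
  simp
  omega

/-- Perturbation of the eigenspace of a simple eigenvalue. -/
theorem exists_hsNorm_eigenker_le (h : IsNonzeroEigensystem T θ ψ)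
    (hT : (T : H →ₗ[ℝ] H).IsSymmetric) (hpos : ∀ x, 0 ≤ (inner ℝ (T x) x : ℝ))
    (hc : IsCompactOperator T) {j : ℕ} (hj : j ∈ indices (opRank T))
    (hone : Module.finrank ℝ (eigenker T (θ j)) = 1) :
    ∃ g : ℝ, 0 < g ∧ ∃ K : ℝ≥0, ∀ (T' : H →L[ℝ] H) (θ' : ℕ → ℝ) (ψ' : ℕ → H),
      IsEigenbasis T' θ' ψ' → (T' : H →ₗ[ℝ] H).IsSymmetric → ‖T' - T‖ ≤ g →
      hsNorm ((eigenker T' (θ' j)).starProjection - (eigenker T (θ j)).starProjection) ≤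
        ENNReal.ofReal (K * ‖T' - T‖) := by
  have hlt : ∀ i ∈ indices (opRank T), j < i → θ i < θ j := fun i hi hji =>
    lt_of_le_of_ne (h.antitone hj hi hji.le)
      fun he => hji.ne' (h.eq_of_finrank_eq_one hi hj hone he)
  have hgt : ∀ i ∈ indices (opRank T), i < j → θ j < θ i := fun i hi hji =>
    lt_of_le_of_ne (h.antitone hi hj hji.le)
      fun he => hji.ne (h.eq_of_finrank_eq_one hi hj hone he.symm)
  -- For `j = 1` there is nothing above and the value 1 is arbitrary.
  have hup : ∃ c : ℝ, 0 < c ∧ ∀ i ∈ indices (opRank T), i < j → θ j + c ≤ θ i := by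
    by_cases hj1 : j = 1
    · exact ⟨1, one_pos, fun i hi hij => by have := hi.1; omega⟩
    · have hj2 : j - 1 ∈ indices (opRank T) :=
        mem_indices_of_le hj (by have := hj.1; omega) (Nat.sub_le _ _)
      refine ⟨θ (j - 1) - θ j, sub_pos.mpr (hgt _ hj2 (by have := hj.1; omega)),
        fun i hi hij => ?_⟩
      have := h.antitone hi hj2 (by omega)
      linarith
  -- If `j` is the last index, the next spectral value to avoid is zero, so `β = 0`; positivity of
  -- `θ j` keeps a gap.
  have hdown : ∃ β : ℝ, 0 ≤ β ∧ β < θ j ∧ ∀ i ∈ indices (opRank T), j < i → θ i ≤ β := by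
    by_cases hj1 : j + 1 ∈ indices (opRank T)
    · exact ⟨θ (j + 1), (h.pos hpos hj1).le, hlt _ hj1 (Nat.lt_succ_self _),
        fun i hi hij => h.antitone hj1 hi hij⟩
    · exact ⟨0, le_rfl, h.pos hpos hj,
        fun i hi hij => absurd (mem_indices_of_le hi (Nat.le_add_left _ _) hij) hj1⟩
  obtain ⟨c₁, hc₁, hup⟩ := hup
  obtain ⟨β, hβ, hβj, hdown⟩ := hdown
  set c := min c₁ (θ j - β) with hcdef
  have hcpos : 0 < c := lt_min hc₁ (sub_pos.mpr hβj)
  have hc1 : c ≤ c₁ := min_le_left _ _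
  have hc2 : c ≤ θ j - β := min_le_right _ _
  -- With a perturbation of at most `c / 4`, `θ' j` stays within `c / 4` of `θ j` and every other
  -- `θ' i` stays at least `3c / 4` away. Hence `θ' j` is simple, and Davis–Kahan applies in
  -- dimension one with gap `c / 2`.
  refine ⟨c / 4, by positivity, Real.toNNReal (Real.sqrt 2 / (c / 2)),
    fun T' θ' ψ' h' hT' hg => ?_⟩
  have hj' := indices_opRank_subset T hj
  have h1 : θ j ≤ θ' j + ‖T' - T‖ := h.eigenvalue_le_add' hT hc h' hT' hj
  have h2 : θ' j ≤ θ j + ‖T' - T‖ :=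
    h.eigenvalue_le_add hT hc h' hT' hj' (k := j - 1) (by have := hj.1; omega)
      (h.pos hpos hj).le fun l hl hjl => h.antitone hj hl (by omega)
  have h3 : ∀ i ∈ indices (Cardinal.toENat (Module.rank ℝ H)), i < j → θ j + c ≤ θ' i + ‖T' - T‖ :=
    fun i hi hij => by
      have hiJ := mem_indices_of_le hj hi.1 hij.le
      have := h.eigenvalue_le_add' hT hc h' hT' hiJ
      have := hup i hiJ hij
      linarith
  have h4 : ∀ i ∈ indices (Cardinal.toENat (Module.rank ℝ H)), j < i → θ' i ≤ θ j - c + ‖T' - T‖ :=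
    fun i hi hij => by
      have := h.eigenvalue_le_add hT hc h' hT' hi hij hβ hdown
      linarith
  have hgap : ∀ i ∈ indices (Cardinal.toENat (Module.rank ℝ H)), i ≠ j → c / 2 ≤ |θ' i - θ j| :=
    fun i hi hij => by
      rcases lt_or_gt_of_ne hij with hij | hij
      · have := h3 i hi hij
        exact le_trans (by linarith) (le_abs_self _)
      · have := h4 i hi hij
        exact le_trans (by linarith) (neg_le_abs _)
  have hker' : eigenker T' (θ' j) = Submodule.span ℝ {ψ' j} := by
    refine h'.eigenker_eq hT' hj' fun i hi hij he => ?_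
    rcases lt_or_gt_of_ne hij with hij | hij
    · have := h3 i hi hij
      linarith
    · have := h4 i hi hij
      linarith
  have hker : eigenker T (θ j) = Submodule.span ℝ {ψ j} := by
    rw [h.multiplicity _ (h.ne_zero j hj)]
    congr 1
    have : {i | i ∈ indices (opRank T) ∧ θ i = θ j} = {j} := by
      ext i
      simp only [Set.mem_ofPred_eq, Set.mem_singleton_iff]
      exact ⟨fun hi => h.eq_of_finrank_eq_one hi.1 hj hone hi.2,
        fun hi => by rw [hi]; exact ⟨hj, rfl⟩⟩
    rw [this, Set.image_singleton]
  have hv : Orthonormal ℝ (fun _ : Unit => ψ j) :=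
    ⟨fun _ => h.norm_eq_one hj, fun a b hab => absurd (Subsingleton.elim a b) hab⟩
  have := hsNorm_starProjection_sub_le h'.hilbertBasis {⟨j, hj'⟩} hv (by simp)
    (eigenker T' (θ' j)) (eigenker T (θ j))
    (by rw [hker', Finset.coe_singleton, Set.image_singleton, h'.hilbertBasis_apply])
    (by rw [hker, Set.range_const]) hT' (l := fun i => θ' i) h'.apply_hilbertBasis
    (T := T) (m := fun _ => θ j) (fun _ => h.apply_eq j hj) (g := c / 2) (by positivity)
    (fun i hi _ => hgap i i.2 fun he => hi (by simp [Subtype.ext_iff, he]))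
  rw [Real.coe_toNNReal _ (by positivity)]
  simpa using this

/-- Perturbation of the range of an operator of finite rank. -/
theorem exists_hsNorm_leadingSpan_le (h : IsNonzeroEigensystem T θ ψ)
    (hT : (T : H →ₗ[ℝ] H).IsSymmetric) (hpos : ∀ x, 0 ≤ (inner ℝ (T x) x : ℝ))
    (hc : IsCompactOperator T) {d : ℕ} (hd : opRank T = d) :
    ∃ g : ℝ, 0 < g ∧ ∃ K : ℝ≥0, ∀ (T' : H →L[ℝ] H) (θ' : ℕ → ℝ) (ψ' : ℕ → H),
      IsEigenbasis T' θ' ψ' → (T' : H →ₗ[ℝ] H).IsSymmetric → ‖T' - T‖ ≤ g →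
      hsNorm ((leadingSpan ψ' d).starProjection - (leadingSpan ψ d).starProjection) ≤
        ENNReal.ofReal (K * ‖T' - T‖) := by
  classical
  have hJ : Set.Icc 1 d ⊆ indices (opRank T) := fun i hi =>
    ⟨hi.1, by rw [hd]; exact_mod_cast hi.2⟩
  obtain ⟨t, ht, hθ⟩ : ∃ t : ℝ, 0 < t ∧ ∀ j ∈ Set.Icc 1 d, t ≤ θ j := by
    rcases Nat.eq_zero_or_pos d with rfl | hd0
    · exact ⟨1, one_pos, fun j hj => by have := hj.1.trans hj.2; omega⟩
    · have hdJ := hJ ⟨hd0, le_rfl⟩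
      exact ⟨θ d, h.pos hpos hdJ, fun j hj => h.antitone (hJ hj) hdJ hj.2⟩
  -- The eigenvalues of `T'` beyond index `d` are at most `t / 2` (Weyl with `β = 0`), while the
  -- nonzero ones of `T` are at least `t`. Davis–Kahan compares just these two groups, so no lower
  -- bound on `θ'` is needed.
  refine ⟨t / 2, by positivity, Real.toNNReal (Real.sqrt (2 * d) / (t / 2)),
    fun T' θ' ψ' h' hT' hg => ?_⟩
  have hJ' : Set.Icc 1 d ⊆ indices (Cardinal.toENat (Module.rank ℝ H)) :=
    hJ.trans (indices_opRank_subset T)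
  let I : Finset (indices (Cardinal.toENat (Module.rank ℝ H))) :=
    Finset.univ.image fun i : Set.Icc 1 d => ⟨i, hJ' i.2⟩
  have hinj : Function.Injective
      fun i : Set.Icc 1 d => (⟨i, hJ' i.2⟩ : indices (Cardinal.toENat (Module.rank ℝ H))) :=
    fun a b hab => by simpa [Subtype.ext_iff] using hab
  have hU : leadingSpan ψ' d = Submodule.span ℝ (h'.hilbertBasis '' I) := by
    rw [IsOrderedEigensystem.leadingSpan_eq]
    congr 1
    ext x
    simp only [I, Finset.coe_image, Finset.coe_univ, Set.image_univ, ← Set.range_comp]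
    simp only [Set.mem_range, Function.comp_apply, h'.hilbertBasis_apply]
  have := hsNorm_starProjection_sub_le h'.hilbertBasis I (h.orthonormal_Icc hJ)
    (by simp [I, Finset.card_image_of_injective _ hinj])
    (leadingSpan ψ' d) (leadingSpan ψ d) hU (IsOrderedEigensystem.leadingSpan_eq ψ d) hT'
    (l := fun i => θ' i) h'.apply_hilbertBasis
    (T := T) (m := fun j => θ j) (fun j => h.apply_eq j (hJ j.2)) (g := t / 2) (by positivity)
    (fun i hi j => by
      have hdi : d < (i : ℕ) := by
        by_contra hid
        exact hi (Finset.mem_image.mpr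
          ⟨⟨i, i.2.1, not_lt.mp hid⟩, Finset.mem_univ _, rfl⟩)
      have h1 := h.eigenvalue_le_add hT hc h' hT' i.2 hdi le_rfl fun l hl hdl => by
        have := hl.2
        rw [hd] at this
        exact absurd (by exact_mod_cast this : l ≤ d) (not_le.mpr hdl)
      have h2 := hθ j j.2
      exact le_trans (by linarith) (neg_le_abs _))
  rw [Real.coe_toNNReal _ (by positivity)]
  simpa using this

end IsNonzeroEigensystem

end Eigensystems

/-! ### The covariance inequality under `ψ`-mixing. -/

section Mixing

variable {Ω : Type v}

/-- Trimming both measures to `m` turns the hypothesis into an inequality of measures. This passes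
from events to functions one factor at a time. -/
theorem lintegral_le_of_forall_measurableSet {m m0 : MeasurableSpace Ω} (hm : m ≤ m0)
    {μ ν : Measure[m0] Ω} (h : ∀ s, MeasurableSet[m] s → μ s ≤ ν s) {f : Ω → ℝ≥0∞}
    (hf : Measurable[m] f) : ∫⁻ ω, f ω ∂μ ≤ ∫⁻ ω, f ω ∂ν := by
  rw [← lintegral_trim hm hf, ← lintegral_trim hm hf]
  refine lintegral_mono' (Measure.le_iff.mpr fun s hs => ?_) le_rfl
  rw [trim_measurableSet_eq hm hs, trim_measurableSet_eq hm hs]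
  exact h s hs

variable {𝒜 ℬ : MeasurableSpace Ω} [mΩ : MeasurableSpace Ω] {P : Measure Ω}

theorem abs_div_sub_one_le_psiDep {A B : Set Ω} (hA : MeasurableSet[𝒜] A)
    (hB : MeasurableSet[ℬ] B) (hA0 : P A ≠ 0) (hB0 : P B ≠ 0) :
    ENNReal.ofReal |P.real (A ∩ B) / (P.real A * P.real B) - 1| ≤ psiDep P 𝒜 ℬ := by
  unfold psiDep
  exact le_iSup_of_le A <| le_iSup_of_le B <| le_iSup_of_le hA <| le_iSup_of_le hB <|
    le_iSup_of_le hA0 <| le_iSup_of_le hB0 le_rfl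

variable [IsProbabilityMeasure P]

theorem measure_inter_le_psiDep {A B : Set Ω} (hA : MeasurableSet[𝒜] A)
    (hB : MeasurableSet[ℬ] B) :
    P (A ∩ B) ≤ (1 + psiDep P 𝒜 ℬ) * P B * P A := by
  by_cases hA0 : P A = 0
  · exact (measure_mono_null Set.inter_subset_left hA0).le.trans zero_le
  by_cases hB0 : P B = 0
  · exact (measure_mono_null Set.inter_subset_right hB0).le.trans zero_le
  have hpos : 0 < P.real A * P.real B :=
    mul_pos (ENNReal.toReal_pos hA0 (measure_ne_top _ _))
      (ENNReal.toReal_pos hB0 (measure_ne_top _ _))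
  set q := P.real A * P.real B with hq
  have hq' : ENNReal.ofReal q = P A * P B := by
    rw [hq, ENNReal.ofReal_mul measureReal_nonneg, ofReal_measureReal, ofReal_measureReal]
  calc P (A ∩ B) = ENNReal.ofReal (P.real (A ∩ B)) := (ofReal_measureReal).symm
    _ ≤ ENNReal.ofReal (q * (1 + |P.real (A ∩ B) / q - 1|)) := by
        refine ENNReal.ofReal_le_ofReal ?_
        have := le_abs_self (P.real (A ∩ B) / q - 1)
        calc P.real (A ∩ B) = q * (P.real (A ∩ B) / q) := by field_simp
          _ ≤ _ := by gcongr; linarith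
    _ = P A * P B * (1 + ENNReal.ofReal |P.real (A ∩ B) / q - 1|) := by
        rw [ENNReal.ofReal_mul hpos.le, hq', ENNReal.ofReal_add zero_le_one (abs_nonneg _),
          ENNReal.ofReal_one]
    _ ≤ P A * P B * (1 + psiDep P 𝒜 ℬ) := by
        gcongr
        exact abs_div_sub_one_le_psiDep hA hB hA0 hB0
    _ = _ := by ring

theorem mul_measure_le_psiDep {A B : Set Ω} (hA : MeasurableSet[𝒜] A)
    (hB : MeasurableSet[ℬ] B) :
    P B * P A ≤ P (A ∩ B) + psiDep P 𝒜 ℬ * P B * P A := by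
  by_cases hA0 : P A = 0
  · simp [hA0]
  by_cases hB0 : P B = 0
  · simp [hB0]
  have hpos : 0 < P.real A * P.real B :=
    mul_pos (ENNReal.toReal_pos hA0 (measure_ne_top _ _))
      (ENNReal.toReal_pos hB0 (measure_ne_top _ _))
  set q := P.real A * P.real B with hq
  have hq' : ENNReal.ofReal q = P A * P B := by
    rw [hq, ENNReal.ofReal_mul measureReal_nonneg, ofReal_measureReal, ofReal_measureReal]
  calc P B * P A = ENNReal.ofReal q := by rw [hq', mul_comm]
    _ ≤ ENNReal.ofReal (P.real (A ∩ B) + q * |P.real (A ∩ B) / q - 1|) := by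
        refine ENNReal.ofReal_le_ofReal ?_
        have := neg_le_abs (P.real (A ∩ B) / q - 1)
        have h2 : P.real (A ∩ B) = q * (P.real (A ∩ B) / q) := by field_simp
        nlinarith
    _ = P (A ∩ B) + P A * P B * ENNReal.ofReal |P.real (A ∩ B) / q - 1| := by
        rw [ENNReal.ofReal_add measureReal_nonneg (by positivity), ofReal_measureReal,
          ENNReal.ofReal_mul hpos.le, hq']
    _ ≤ P (A ∩ B) + P A * P B * psiDep P 𝒜 ℬ := by
        gcongr
        exact abs_div_sub_one_le_psiDep hA hB hA0 hB0
    _ = _ := by ring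

/-- For fixed `B`, the restriction of `P` to `B` is compared on `𝒜` with a multiple of `P`, which
inserts `X`. Then the measure with density `X` is compared on `ℬ` with a multiple of `P`, which
inserts `Y`. -/
theorem lintegral_mul_le_psiDep (h𝒜 : 𝒜 ≤ mΩ) (hℬ : ℬ ≤ mΩ) {X Y : Ω → ℝ≥0∞}
    (hX : Measurable[𝒜] X) (hY : Measurable[ℬ] Y) :
    ∫⁻ ω, X ω * Y ω ∂P ≤ (1 + psiDep P 𝒜 ℬ) * (∫⁻ ω, X ω ∂P) * ∫⁻ ω, Y ω ∂P := by
  have h1 : ∀ B, MeasurableSet[ℬ] B →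
      ∫⁻ ω in B, X ω ∂P ≤ (1 + psiDep P 𝒜 ℬ) * P B * ∫⁻ ω, X ω ∂P := fun B hB => by
    rw [← smul_eq_mul, ← lintegral_smul_measure]
    refine lintegral_le_of_forall_measurableSet h𝒜 (fun A hA => ?_) hX
    rw [Measure.restrict_apply (h𝒜 _ hA), Measure.smul_apply, smul_eq_mul]
    exact measure_inter_le_psiDep hA hB
  have h2 := lintegral_withDensity_eq_lintegral_mul P (hX.mono h𝒜 le_rfl) (hY.mono hℬ le_rfl)
  simp only [Pi.mul_apply] at h2
  rw [← h2, ← smul_eq_mul, ← lintegral_smul_measure]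
  refine lintegral_le_of_forall_measurableSet hℬ (fun B hB => ?_) hY
  rw [withDensity_apply _ (hℬ _ hB), Measure.smul_apply, smul_eq_mul]
  exact (h1 B hB).trans_eq (by ring)

/-- The lower bound, by the same two comparisons; the error stands on the right as an added measure,
so that nothing is subtracted in `ℝ≥0∞`. -/
theorem mul_lintegral_le_psiDep (h𝒜 : 𝒜 ≤ mΩ) (hℬ : ℬ ≤ mΩ) {X Y : Ω → ℝ≥0∞}
    (hX : Measurable[𝒜] X) (hY : Measurable[ℬ] Y) :
    (∫⁻ ω, X ω ∂P) * ∫⁻ ω, Y ω ∂P ≤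
      ∫⁻ ω, X ω * Y ω ∂P + psiDep P 𝒜 ℬ * (∫⁻ ω, X ω ∂P) * ∫⁻ ω, Y ω ∂P := by
  have h1 : ∀ B, MeasurableSet[ℬ] B →
      P B * ∫⁻ ω, X ω ∂P ≤
        ∫⁻ ω in B, X ω ∂P + psiDep P 𝒜 ℬ * P B * ∫⁻ ω, X ω ∂P := fun B hB => by
    rw [← smul_eq_mul, ← lintegral_smul_measure, ← smul_eq_mul, ← lintegral_smul_measure,
      ← lintegral_add_measure]
    refine lintegral_le_of_forall_measurableSet h𝒜 (fun A hA => ?_) hX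
    rw [Measure.add_apply, Measure.restrict_apply (h𝒜 _ hA), Measure.smul_apply,
      Measure.smul_apply, smul_eq_mul, smul_eq_mul]
    exact mul_measure_le_psiDep hA hB
  have h2 := lintegral_withDensity_eq_lintegral_mul P (hX.mono h𝒜 le_rfl) (hY.mono hℬ le_rfl)
  simp only [Pi.mul_apply] at h2
  rw [← h2, ← smul_eq_mul, ← lintegral_smul_measure,
    ← smul_eq_mul (psiDep P 𝒜 ℬ * ∫⁻ ω, X ω ∂P), ← lintegral_smul_measure,
    ← lintegral_add_measure]
  refine lintegral_le_of_forall_measurableSet hℬ (fun B hB => ?_) hY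
  rw [Measure.add_apply, withDensity_apply _ (hℬ _ hB), Measure.smul_apply, Measure.smul_apply,
    smul_eq_mul, smul_eq_mul]
  refine (Eq.trans_le (by ring) (h1 B hB)).trans_eq (by ring)

theorem integral_mul_bounds_psiDep (h𝒜 : 𝒜 ≤ mΩ) (hℬ : ℬ ≤ mΩ) (hψ : psiDep P 𝒜 ℬ ≠ ∞)
    {X Y : Ω → ℝ} (hX : Measurable[𝒜] X) (hY : Measurable[ℬ] Y) (hX0 : 0 ≤ X) (hY0 : 0 ≤ Y)
    (hXi : Integrable X P) (hYi : Integrable Y P) (hXY : Integrable (fun ω => X ω * Y ω) P) :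
    ∫ ω, X ω * Y ω ∂P ≤ (1 + (psiDep P 𝒜 ℬ).toReal) * (∫ ω, X ω ∂P) * ∫ ω, Y ω ∂P ∧
    (∫ ω, X ω ∂P) * ∫ ω, Y ω ∂P ≤
      ∫ ω, X ω * Y ω ∂P + (psiDep P 𝒜 ℬ).toReal * (∫ ω, X ω ∂P) * ∫ ω, Y ω ∂P := by
  have e1 := ofReal_integral_eq_lintegral_ofReal hXi (Eventually.of_forall hX0)
  have e2 := ofReal_integral_eq_lintegral_ofReal hYi (Eventually.of_forall hY0)
  have e3 := ofReal_integral_eq_lintegral_ofReal hXY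
    (Eventually.of_forall fun ω => mul_nonneg (hX0 ω) (hY0 ω))
  have e3' : ∫⁻ ω, ENNReal.ofReal (X ω * Y ω) ∂P =
      ∫⁻ ω, ENNReal.ofReal (X ω) * ENNReal.ofReal (Y ω) ∂P :=
    lintegral_congr fun ω => ENNReal.ofReal_mul (hX0 ω)
  have hmX : Measurable[𝒜] fun ω => ENNReal.ofReal (X ω) := ENNReal.measurable_ofReal.comp hX
  have hmY : Measurable[ℬ] fun ω => ENNReal.ofReal (Y ω) := ENNReal.measurable_ofReal.comp hY
  have u := lintegral_mul_le_psiDep (P := P) h𝒜 hℬ hmX hmY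
  have l := mul_lintegral_le_psiDep (P := P) h𝒜 hℬ hmX hmY
  rw [← e3', ← e1, ← e2, ← e3] at u l
  have i1 : 0 ≤ ∫ ω, X ω ∂P := integral_nonneg hX0
  have i2 : 0 ≤ ∫ ω, Y ω ∂P := integral_nonneg hY0
  have i3 : 0 ≤ ∫ ω, X ω * Y ω ∂P := integral_nonneg fun ω => mul_nonneg (hX0 ω) (hY0 ω)
  have hψ' : psiDep P 𝒜 ℬ = ENNReal.ofReal (psiDep P 𝒜 ℬ).toReal := (ENNReal.ofReal_toReal hψ).symm
  have i4 : 0 ≤ (psiDep P 𝒜 ℬ).toReal := ENNReal.toReal_nonneg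
  rw [hψ'] at u l
  generalize (psiDep P 𝒜 ℬ).toReal = p at *
  constructor
  · rw [← ENNReal.ofReal_one, ← ENNReal.ofReal_add zero_le_one i4,
      ← ENNReal.ofReal_mul (by positivity), ← ENNReal.ofReal_mul (by positivity)] at u
    exact (ENNReal.ofReal_le_ofReal_iff (by positivity)).mp u
  · rw [← ENNReal.ofReal_mul i4, ← ENNReal.ofReal_mul (by positivity),
      ← ENNReal.ofReal_mul (by positivity), ← ENNReal.ofReal_add i3 (by positivity)] at l
    exact (ENNReal.ofReal_le_ofReal_iff (by positivity)).mp l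

/-- The covariance inequality for the `ψ`-dependence coefficient. -/
theorem integral_mul_le_psiDep (h𝒜 : 𝒜 ≤ mΩ) (hℬ : ℬ ≤ mΩ) (hψ : psiDep P 𝒜 ℬ ≠ ∞)
    {X Y : Ω → ℝ} (hX : Measurable[𝒜] X) (hY : Measurable[ℬ] Y)
    (hX2 : MemLp X 2 P) (hY2 : MemLp Y 2 P) :
    ∫ ω, X ω * Y ω ∂P ≤ (∫ ω, X ω ∂P) * (∫ ω, Y ω ∂P) +
      (psiDep P 𝒜 ℬ).toReal * (∫ ω, |X ω| ∂P) * ∫ ω, |Y ω| ∂P := by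
  -- Positive and negative parts: the products of like sign are bounded above and the mixed ones
  -- below. The four error terms add up to the coefficient times `E|X| E|Y|`.
  let p : (Ω → ℝ) → Ω → ℝ := fun Z ω => max (Z ω) 0
  let q : (Ω → ℝ) → Ω → ℝ := fun Z ω => max (-Z ω) 0
  have hp0 : ∀ Z, 0 ≤ p Z := fun Z ω => le_max_right _ _
  have hq0 : ∀ Z, 0 ≤ q Z := fun Z ω => le_max_right _ _
  have hpq : ∀ Z ω, Z ω = p Z ω - q Z ω := fun Z ω => by
    rcases le_total (Z ω) 0 with h | h
    · simp [p, q, h]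
    · simp [p, q, h]
  have hpq' : ∀ Z ω, |Z ω| = p Z ω + q Z ω := fun Z ω => by
    rcases le_total (Z ω) 0 with h | h
    · simp [p, q, h, abs_of_nonpos]
    · simp [p, q, h, abs_of_nonneg]
  have hpm : ∀ {m : MeasurableSpace Ω} {Z : Ω → ℝ}, Measurable[m] Z → Measurable[m] (p Z) :=
    fun h => h.max measurable_const
  have hqm : ∀ {m : MeasurableSpace Ω} {Z : Ω → ℝ}, Measurable[m] Z → Measurable[m] (q Z) :=
    fun h => h.neg.max measurable_const
  have hp2 : ∀ {Z}, MemLp Z 2 P → MemLp (p Z) 2 P := fun h => h.pos_part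
  have hq2 : ∀ {Z}, MemLp Z 2 P → MemLp (q Z) 2 P := fun h => h.neg_part
  have i1 : ∀ {Z : Ω → ℝ}, MemLp Z 2 P → Integrable Z P := fun h => h.integrable one_le_two
  have i2 : ∀ {Z W : Ω → ℝ}, MemLp Z 2 P → MemLp W 2 P → Integrable (fun ω => Z ω * W ω) P :=
    fun h h' => h.integrable_mul h'
  have bpp := (integral_mul_bounds_psiDep h𝒜 hℬ hψ (hpm hX) (hpm hY) (hp0 X) (hp0 Y)
    (i1 (hp2 hX2)) (i1 (hp2 hY2)) (i2 (hp2 hX2) (hp2 hY2))).1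
  have bqq := (integral_mul_bounds_psiDep h𝒜 hℬ hψ (hqm hX) (hqm hY) (hq0 X) (hq0 Y)
    (i1 (hq2 hX2)) (i1 (hq2 hY2)) (i2 (hq2 hX2) (hq2 hY2))).1
  have bpq := (integral_mul_bounds_psiDep h𝒜 hℬ hψ (hpm hX) (hqm hY) (hp0 X) (hq0 Y)
    (i1 (hp2 hX2)) (i1 (hq2 hY2)) (i2 (hp2 hX2) (hq2 hY2))).2
  have bqp := (integral_mul_bounds_psiDep h𝒜 hℬ hψ (hqm hX) (hpm hY) (hq0 X) (hp0 Y)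
    (i1 (hq2 hX2)) (i1 (hp2 hY2)) (i2 (hq2 hX2) (hp2 hY2))).2
  have eXY : ∫ ω, X ω * Y ω ∂P = (∫ ω, p X ω * p Y ω ∂P) + (∫ ω, q X ω * q Y ω ∂P) -
      ((∫ ω, p X ω * q Y ω ∂P) + ∫ ω, q X ω * p Y ω ∂P) := by
    have j1 : Integrable (fun ω => p X ω * p Y ω + q X ω * q Y ω) P :=
      (i2 (hp2 hX2) (hp2 hY2)).add (i2 (hq2 hX2) (hq2 hY2))
    have j2 : Integrable (fun ω => p X ω * q Y ω + q X ω * p Y ω) P :=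
      (i2 (hp2 hX2) (hq2 hY2)).add (i2 (hq2 hX2) (hp2 hY2))
    rw [← integral_add (i2 (hp2 hX2) (hp2 hY2)) (i2 (hq2 hX2) (hq2 hY2)),
      ← integral_add (i2 (hp2 hX2) (hq2 hY2)) (i2 (hq2 hX2) (hp2 hY2)), ← integral_sub j1 j2]
    refine integral_congr_ae (Eventually.of_forall fun ω => ?_)
    simp only
    rw [hpq X ω, hpq Y ω]
    ring
  have e : ∀ {Z}, MemLp Z 2 P → ∫ ω, Z ω ∂P = (∫ ω, p Z ω ∂P) - ∫ ω, q Z ω ∂P := fun {Z} h => by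
    rw [← integral_sub (i1 (hp2 h)) (i1 (hq2 h))]
    exact integral_congr_ae (Eventually.of_forall fun ω => hpq Z ω)
  have e' : ∀ {Z}, MemLp Z 2 P → ∫ ω, |Z ω| ∂P = (∫ ω, p Z ω ∂P) + ∫ ω, q Z ω ∂P := fun {Z} h => by
    rw [← integral_add (i1 (hp2 h)) (i1 (hq2 h))]
    exact integral_congr_ae (Eventually.of_forall fun ω => hpq' Z ω)
  rw [eXY, e hX2, e hY2, e' hX2, e' hY2]
  linarith

end Mixing

/-! ### Second moments of weakly dependent sums and the passage to stochastic order. -/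

section SecondMoments

variable {Ω : Type v} [MeasurableSpace Ω] {P : Measure Ω}

/-- With truncated subtraction `(s - t) + (t - s)` is `|s - t|`, and each distance occurs at most
once on either side of `s`. -/
theorem sum_dist_le_two_mul_tsum {c : ℕ → ℝ} (hc0 : ∀ k, 0 ≤ c k) (hc : Summable c)
    (I : Finset ℕ) (s : ℕ) : ∑ t ∈ I, c ((s - t) + (t - s)) ≤ 2 * ∑' k, c k := by
  have key : ∀ (I : Finset ℕ) (f : ℕ → ℕ), Set.InjOn f I → ∑ t ∈ I, c (f t) ≤ ∑' k, c k :=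
    fun I f hf => by
      rw [← Finset.sum_image (f := c) hf]
      exact hc.sum_le_tsum _ fun i _ => hc0 i
  rw [← Finset.sum_filter_add_sum_filter_not I (fun t => t ≤ s), two_mul]
  refine add_le_add (key _ _ ?_) (key _ _ ?_)
  · intro a ha b hb hab
    simp only [Finset.coe_filter, Set.mem_ofPred_eq] at ha hb hab
    omega
  · intro a ha b hb hab
    simp only [Finset.coe_filter, Set.mem_ofPred_eq] at ha hb hab
    omega

theorem integral_mul_le_half_add {X Y : Ω → ℝ} (hX : MemLp X 2 P) (hY : MemLp Y 2 P) :
    ∫ ω, X ω * Y ω ∂P ≤ (∫ ω, X ω ^ 2 ∂P + ∫ ω, Y ω ^ 2 ∂P) / 2 := by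
  have h : Integrable (fun ω => (X ω ^ 2 + Y ω ^ 2) / 2) P :=
    (hX.integrable_sq.add hY.integrable_sq).div_const 2
  rw [← integral_add hX.integrable_sq hY.integrable_sq, ← integral_div]
  refine integral_mono (hX.integrable_mul hY) h fun ω => ?_
  nlinarith [sq_nonneg (X ω - Y ω)]

/-- Quantities dominated, locally, by variables with second moments of order `1 / n` are
`O_P(n^(-1/2))`. -/
theorem isBigOInProb_of_lintegral_sq_le {D X : ℕ → Ω → ℝ≥0∞} {L : ℝ≥0}
    (hDm : ∀ n, AEMeasurable (fun ω => D n ω ^ 2) P)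
    (hD : ∀ n : ℕ, 2 ≤ n → ∫⁻ ω, D n ω ^ 2 ∂P ≤ ENNReal.ofReal (L / n))
    {δ : ℝ} (hδ : 0 < δ) {K : ℝ≥0}
    (hX : ∀ n ω, D n ω ≤ ENNReal.ofReal δ → X n ω ≤ K * D n ω) :
    IsBigOInProb P X (fun n => (n : ℝ) ^ (-(1 / 2) : ℝ)) := by
  intro ε hε
  -- Capping at 1 covers `ε = ∞`. The choice `M² ≥ L / η` below makes Markov's bound `L / M²` at
  -- most `η`.
  set η : ℝ := (min ε 1).toReal with hη
  have hminne : min ε 1 ≠ ∞ := ne_top_of_le_ne_top ENNReal.one_ne_top (min_le_right _ _)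
  have hη0 : 0 < η := ENNReal.toReal_pos (lt_min hε one_pos).ne' hminne
  set M : ℝ := Real.sqrt (L / η) + 1 with hM
  have hM0 : 0 < M := by positivity
  have hM2 : L / η ≤ M ^ 2 := by
    have h1 := Real.sq_sqrt (show (0 : ℝ) ≤ L / η by positivity)
    have h2 := Real.sqrt_nonneg (L / η : ℝ)
    rw [hM]
    nlinarith
  have hlim : Tendsto (fun n : ℕ => M * (n : ℝ) ^ (-(1 / 2) : ℝ)) atTop (𝓝 0) := by
    have := (tendsto_rpow_neg_atTop (show (0 : ℝ) < 1 / 2 by norm_num)).comp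
      tendsto_natCast_atTop_atTop
    simpa using this.const_mul M
  obtain ⟨N, hN⟩ := eventually_atTop.mp (hlim.eventually (gt_mem_nhds hδ))
  refine ⟨K * Real.toNNReal M, max N 2, fun n hn => ?_⟩
  have hn2 : 2 ≤ n := (le_max_right _ _).trans hn
  have hn0 : (0 : ℝ) < n := by exact_mod_cast lt_of_lt_of_le two_pos hn2
  have hsmall := hN n ((le_max_left _ _).trans hn)
  set a : ℝ := (n : ℝ) ^ (-(1 / 2) : ℝ) with ha
  have ha0 : 0 < a := Real.rpow_pos_of_pos hn0 _
  have ha2 : a ^ 2 = (n : ℝ)⁻¹ := by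
    rw [ha, ← Real.rpow_natCast, ← Real.rpow_mul hn0.le, ← Real.rpow_neg_one]
    norm_num
  -- Where `D n` is below `M n^(-1/2)`, hence below `δ`, the local domination applies. Only `D`
  -- needs to be measurable, not `X`.
  have hsub : {ω | ENNReal.ofReal (((K * Real.toNNReal M : ℝ≥0) : ℝ) * a) < X n ω} ⊆
      {ω | ENNReal.ofReal (M ^ 2 / n) ≤ D n ω ^ 2} := by
    intro ω hω
    simp only [Set.mem_ofPred_eq] at hω ⊢
    by_contra hlt
    rw [not_le] at hlt
    have h1 : D n ω ≤ ENNReal.ofReal (M * a) := by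
      refine (ENNReal.pow_le_pow_left_iff two_ne_zero).mp ?_
      rw [← ENNReal.ofReal_pow (by positivity), mul_pow, ha2, ← div_eq_mul_inv]
      exact hlt.le
    have h2 := hX n ω (h1.trans (ENNReal.ofReal_le_ofReal hsmall.le))
    refine hω.not_ge (h2.trans ?_)
    calc (K : ℝ≥0∞) * D n ω ≤ K * ENNReal.ofReal (M * a) := by gcongr
      _ = _ := by
        rw [NNReal.coe_mul, Real.coe_toNNReal _ hM0.le, mul_assoc,
          ENNReal.ofReal_mul NNReal.zero_le_coe, ENNReal.ofReal_coe_nnreal]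
  have hpos : 0 < M ^ 2 / (n : ℝ) := by positivity
  calc P {ω | ENNReal.ofReal (((K * Real.toNNReal M : ℝ≥0) : ℝ) * a) < X n ω}
      ≤ P {ω | ENNReal.ofReal (M ^ 2 / n) ≤ D n ω ^ 2} := measure_mono hsub
    _ ≤ (∫⁻ ω, D n ω ^ 2 ∂P) / ENNReal.ofReal (M ^ 2 / n) :=
        meas_ge_le_lintegral_div (hDm n) (by simpa using hpos) ENNReal.ofReal_ne_top
    _ ≤ ENNReal.ofReal (L / n) / ENNReal.ofReal (M ^ 2 / n) := by gcongr; exact hD n hn2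
    _ = ENNReal.ofReal ((L / n) / (M ^ 2 / n)) := (ENNReal.ofReal_div_of_pos hpos).symm
    _ ≤ ENNReal.ofReal η := by
        refine ENNReal.ofReal_le_ofReal ?_
        rw [div_div_div_cancel_right₀ hn0.ne', div_le_iff₀ (by positivity)]
        rw [div_le_iff₀ hη0] at hM2
        linarith
    _ ≤ ε := by
        rw [hη, ENNReal.ofReal_toReal hminne]
        exact min_le_left _ _

variable [IsProbabilityMeasure P]

/-- The second moment of a sum of weakly dependent variables with mean `r`. -/
theorem integral_sum_sub_sq_le {c : ℕ → ℝ} (hc0 : ∀ k, 0 ≤ c k) (hc : Summable c)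
    (I : Finset ℕ) {x : ℕ → Ω → ℝ} {r : ℝ} (hx : ∀ t ∈ I, MemLp (x t) 2 P)
    (hr : ∀ t ∈ I, ∫ ω, x t ω ∂P = r)
    (hcov : ∀ s ∈ I, ∀ t ∈ I, s ≤ t → ∫ ω, x s ω * x t ω ∂P - r ^ 2 ≤
      c (t - s) * ((∫ ω, x s ω ^ 2 ∂P + ∫ ω, x t ω ^ 2 ∂P) / 2)) :
    ∫ ω, (∑ t ∈ I, (x t ω - r)) ^ 2 ∂P ≤ 2 * (∑' k, c k) * ∑ t ∈ I, ∫ ω, x t ω ^ 2 ∂P := by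
  have hxr : ∀ t ∈ I, MemLp (fun ω => x t ω - r) 2 P := fun t ht => (hx t ht).sub (memLp_const r)
  have hint : ∀ s ∈ I, ∀ t ∈ I, Integrable (fun ω => (x s ω - r) * (x t ω - r)) P :=
    fun s hs t ht => (hxr s hs).integrable_mul (hxr t ht)
  have hprod : ∀ s ∈ I, ∀ t ∈ I, ∫ ω, (x s ω - r) * (x t ω - r) ∂P =
      ∫ ω, x s ω * x t ω ∂P - r ^ 2 := fun s hs t ht => by
    have i1 : Integrable (fun ω => x s ω * x t ω) P := (hx s hs).integrable_mul (hx t ht)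
    have i2 : Integrable (fun ω => r * x s ω) P := ((hx s hs).integrable one_le_two).const_mul r
    have i3 : Integrable (fun ω => r * x t ω) P := ((hx t ht).integrable one_le_two).const_mul r
    have i4 : Integrable (fun ω => r * x t ω - r ^ 2) P := i3.sub (integrable_const _)
    have i5 : Integrable (fun ω => r * x s ω + (r * x t ω - r ^ 2)) P := i2.add i4
    have : ∀ ω, (x s ω - r) * (x t ω - r) =
        x s ω * x t ω - (r * x s ω + (r * x t ω - r ^ 2)) := fun ω => by ring
    simp_rw [this]
    rw [integral_sub i1 i5, integral_add i2 i4, integral_sub i3 (integrable_const _),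
      integral_const_mul, integral_const_mul, hr s hs, hr t ht]
    simp
    ring
  have hsq : ∀ ω, (∑ t ∈ I, (x t ω - r)) ^ 2 =
      ∑ s ∈ I, ∑ t ∈ I, (x s ω - r) * (x t ω - r) := fun ω => by
    rw [sq, Finset.sum_mul_sum]
  simp_rw [hsq]
  rw [integral_finsetSum _ fun s hs => integrable_finsetSum _ fun t ht => hint s hs t ht]
  set w : ℕ → ℝ := fun t => ∫ ω, x t ω ^ 2 ∂P with hw
  have hw0 : ∀ t, 0 ≤ w t := fun t => integral_nonneg fun ω => sq_nonneg _
  calc ∑ s ∈ I, ∫ ω, ∑ t ∈ I, (x s ω - r) * (x t ω - r) ∂P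
      = ∑ s ∈ I, ∑ t ∈ I, (∫ ω, x s ω * x t ω ∂P - r ^ 2) := by
        refine Finset.sum_congr rfl fun s hs => ?_
        rw [integral_finsetSum _ fun t ht => hint s hs t ht]
        exact Finset.sum_congr rfl fun t ht => hprod s hs t ht
    _ ≤ ∑ s ∈ I, ∑ t ∈ I, c ((s - t) + (t - s)) * ((w s + w t) / 2) := by
        refine Finset.sum_le_sum fun s hs => Finset.sum_le_sum fun t ht => ?_
        rcases le_total s t with h | h
        · have := hcov s hs t ht h
          rwa [Nat.sub_eq_zero_of_le h, zero_add]
        · have := hcov t ht s hs h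
          rw [Nat.sub_eq_zero_of_le h, add_zero, add_comm (w s)]
          simpa only [mul_comm (x t _)] using this
    -- The weights are symmetric in `s` and `t`, so the average of `w s` and `w t` may be replaced
    -- by `w s`.
    _ = ∑ s ∈ I, ∑ t ∈ I, c ((s - t) + (t - s)) * w s := by
        have h1 : ∑ s ∈ I, ∑ t ∈ I, c ((s - t) + (t - s)) * w t =
            ∑ s ∈ I, ∑ t ∈ I, c ((s - t) + (t - s)) * w s := by
          rw [Finset.sum_comm]
          refine Finset.sum_congr rfl fun s _ => Finset.sum_congr rfl fun t _ => ?_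
          rw [add_comm]
        have h2 : ∑ s ∈ I, ∑ t ∈ I, c ((s - t) + (t - s)) * ((w s + w t) / 2) =
            (∑ s ∈ I, ∑ t ∈ I, c ((s - t) + (t - s)) * w s) / 2 +
            (∑ s ∈ I, ∑ t ∈ I, c ((s - t) + (t - s)) * w t) / 2 := by
          simp_rw [Finset.sum_div, ← Finset.sum_add_distrib]
          refine Finset.sum_congr rfl fun s _ => Finset.sum_congr rfl fun t _ => ?_
          ring
        rw [h2, h1]
        ring
    _ ≤ ∑ s ∈ I, (2 * ∑' k, c k) * w s := by
        refine Finset.sum_le_sum fun s _ => ?_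
        rw [← Finset.sum_mul]
        exact mul_le_mul_of_nonneg_right (sum_dist_le_two_mul_tsum hc0 hc I s) (hw0 s)
    _ = _ := by rw [← Finset.mul_sum]

/-- Integration of `2 m |X| - m² ≤ X²` with `m = E|X|`. -/
theorem sq_integral_abs_le {X : Ω → ℝ} (hX : MemLp X 2 P) :
    (∫ ω, |X ω| ∂P) ^ 2 ≤ ∫ ω, X ω ^ 2 ∂P := by
  have h1 : Integrable (fun ω => |X ω|) P := (hX.integrable one_le_two).abs
  set m := ∫ ω, |X ω| ∂P with hm
  have h2 : Integrable (fun ω => 2 * m * |X ω| - m ^ 2) P :=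
    (h1.const_mul _).sub (integrable_const _)
  have h3 : ∫ ω, (2 * m * |X ω| - m ^ 2) ∂P ≤ ∫ ω, X ω ^ 2 ∂P :=
    integral_mono h2 hX.integrable_sq fun ω => by
      nlinarith [sq_nonneg (|X ω| - m), sq_abs (X ω)]
  rw [integral_sub (h1.const_mul _) (integrable_const _), integral_const_mul] at h3
  simp only [integral_const, probReal_univ, one_smul] at h3
  nlinarith

/-- Each coefficient is the square of its root, and each root is at most its term `a k`, itself at
most the finite total. Only this summability of the coefficients is used afterwards. -/
theorem tsum_ne_top_of_tsum_mul_rpow {p : ℕ → ℝ≥0∞}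
    (h : ∑' k : ℕ, ((k + 1 : ℕ) : ℝ≥0∞) * p (k + 1) ^ (1 / 2 : ℝ) < ∞) :
    ∑' k : ℕ, p (k + 1) ≠ ∞ := by
  set a : ℕ → ℝ≥0∞ := fun k => ((k + 1 : ℕ) : ℝ≥0∞) * p (k + 1) ^ (1 / 2 : ℝ) with ha
  have h1 : ∀ k, p (k + 1) ≤ (∑' k, a k) * a k := fun k => by
    have h2 : p (k + 1) ^ (1 / 2 : ℝ) ≤ a k := by
      refine le_mul_of_one_le_left zero_le ?_
      exact_mod_cast Nat.succ_le_succ (Nat.zero_le k)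
    calc p (k + 1) = p (k + 1) ^ (1 / 2 : ℝ) * p (k + 1) ^ (1 / 2 : ℝ) := by
          rw [← ENNReal.rpow_add_of_nonneg _ _ (by norm_num) (by norm_num)]
          norm_num
      _ ≤ (∑' k, a k) * a k := mul_le_mul' (h2.trans (ENNReal.le_tsum k)) h2
  refine ne_top_of_le_ne_top ?_ (ENNReal.tsum_le_tsum h1)
  rw [ENNReal.tsum_mul_left]
  exact ENNReal.mul_ne_top h.ne h.ne

end SecondMoments

/-- The covariance inequality in the form consumed by `integral_sum_sub_sq_le`: `E|X| E|Y|` is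
replaced by the mean of the second moments. -/
theorem integral_mul_sub_le_psiDep {Ω : Type v} {𝒜 ℬ : MeasurableSpace Ω} {mΩ : MeasurableSpace Ω}
    {P : Measure Ω} [IsProbabilityMeasure P] (h𝒜 : 𝒜 ≤ mΩ) (hℬ : ℬ ≤ mΩ)
    {p : ℝ≥0∞} (hp : psiDep P 𝒜 ℬ ≤ p) (hp' : p ≠ ∞)
    {X Y : Ω → ℝ} (hX : Measurable[𝒜] X) (hY : Measurable[ℬ] Y)
    (hX2 : MemLp X 2 P) (hY2 : MemLp Y 2 P) :
    ∫ ω, X ω * Y ω ∂P - (∫ ω, X ω ∂P) * (∫ ω, Y ω ∂P) ≤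
      p.toReal * ((∫ ω, X ω ^ 2 ∂P + ∫ ω, Y ω ^ 2 ∂P) / 2) := by
  have h := integral_mul_le_psiDep h𝒜 hℬ (ne_top_of_le_ne_top hp' hp) hX hY hX2 hY2
  have h1 : (psiDep P 𝒜 ℬ).toReal ≤ p.toReal := ENNReal.toReal_mono hp' hp
  have h2 := sq_integral_abs_le hX2
  have h3 := sq_integral_abs_le hY2
  have h4 : 0 ≤ ∫ ω, |X ω| ∂P := integral_nonneg fun ω => abs_nonneg _
  have h5 : 0 ≤ ∫ ω, |Y ω| ∂P := integral_nonneg fun ω => abs_nonneg _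
  have h6 : (∫ ω, |X ω| ∂P) * ∫ ω, |Y ω| ∂P ≤
      (∫ ω, X ω ^ 2 ∂P + ∫ ω, Y ω ^ 2 ∂P) / 2 := by
    nlinarith [sq_nonneg ((∫ ω, |X ω| ∂P) - ∫ ω, |Y ω| ∂P)]
  have h7 : (psiDep P 𝒜 ℬ).toReal * ((∫ ω, |X ω| ∂P) * ∫ ω, |Y ω| ∂P) ≤
      p.toReal * ((∫ ω, X ω ^ 2 ∂P + ∫ ω, Y ω ^ 2 ∂P) / 2) :=
    mul_le_mul h1 h6 (by positivity) ENNReal.toReal_nonneg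
  linarith

theorem IsStrictlyStationary.lintegral_enorm_pow {Ω : Type v} [MeasurableSpace Ω] {P : Measure Ω}
    {H : Type u} [NormedAddCommGroup H] [MeasurableSpace H] [BorelSpace H] {𝕋 : Set ℤ}
    {ζ : ℤ → Ω → H} (hs : IsStrictlyStationary P 𝕋 ζ) (hζ : ∀ t ∈ 𝕋, Measurable (ζ t))
    (h0 : (0 : ℤ) ∈ 𝕋) (k : ℕ) (hk : (k : ℤ) ∈ 𝕋) (p : ℕ) :
    ∫⁻ ω, ‖ζ k ω‖ₑ ^ p ∂P = ∫⁻ ω, ‖ζ 0 ω‖ₑ ^ p ∂P := by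
  have h := hs {0} (by simpa using h0) k
  let z : ({0} : Finset ℤ) := ⟨0, by simp⟩
  have hmeas : Measurable fun g : ({0} : Finset ℤ) → H => ‖g z‖ₑ ^ p :=
    (measurable_pi_apply z).enorm.pow_const p
  have hval : ∀ t : ({0} : Finset ℤ), (t : ℤ) = 0 := fun t => Finset.mem_singleton.mp t.2
  have m1 : Measurable fun ω (t : ({0} : Finset ℤ)) => ζ ((t : ℤ) + k) ω :=
    measurable_pi_iff.mpr fun t => by
      rw [hval t, zero_add]
      exact hζ _ hk
  have m2 : Measurable fun ω (t : ({0} : Finset ℤ)) => ζ (t : ℤ) ω :=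
    measurable_pi_iff.mpr fun t => by
      rw [hval t]
      exact hζ _ h0
  have e := congrArg (fun μ => ∫⁻ g, ‖g z‖ₑ ^ p ∂μ) h
  rw [lintegral_map hmeas m1, lintegral_map hmeas m2] at e
  simpa [z] using e

/-! ### Covariance operators and the unbiasedness of the lag-one products. -/

section Model

variable {H : Type u} [NormedAddCommGroup H] [InnerProductSpace ℝ H]

/-- Basis vectors have mutual distance `√2`, so the balls of radius `1/2` are disjoint. Countability
is what allows sums over the basis to be exchanged with integrals. -/
theorem countable_of_hilbertBasis [TopologicalSpace.SeparableSpace H] {ι : Type*}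
    (b : HilbertBasis ι ℝ H) : Countable ι := by
  refine Pairwise.countable_of_isOpen_disjoint (s := fun i => Metric.ball (b i) (1 / 2))
    (fun i j hij => Metric.ball_disjoint_ball ?_) (fun i => Metric.isOpen_ball)
    (fun i => ⟨b i, Metric.mem_ball_self (by norm_num)⟩)
  have h1 := norm_sub_sq_real (b i) (b j)
  rw [b.orthonormal.inner_eq_zero hij, b.orthonormal.norm_eq_one, b.orthonormal.norm_eq_one] at h1
  rw [dist_eq_norm]
  nlinarith [norm_nonneg (b i - b j)]

variable {Ω : Type v} [MeasurableSpace Ω] {P : Measure Ω}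

theorem integrable_rankOne {ξ η : Ω → H} (hξ : MemLp ξ 2 P) (hη : MemLp η 2 P) :
    Integrable (fun ω => InnerProductSpace.rankOne ℝ (η ω) (ξ ω)) P := by
  have hc : Continuous fun p : H × H => InnerProductSpace.rankOne ℝ p.1 p.2 :=
    ((InnerProductSpace.rankOne ℝ).continuous.comp continuous_fst).clm_apply continuous_snd
  have hm : AEStronglyMeasurable (fun ω => InnerProductSpace.rankOne ℝ (η ω) (ξ ω)) P :=
    Continuous.comp_aestronglyMeasurable (g := fun p : H × H => InnerProductSpace.rankOne ℝ p.1 p.2)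
      (f := fun ω => (η ω, ξ ω)) hc (hη.1.prodMk hξ.1)
  have hb : Integrable (fun ω => ‖η ω‖ * ‖ξ ω‖) P := hη.norm.integrable_mul hξ.norm
  refine hb.mono' hm (Eventually.of_forall fun ω => ?_)
  rw [InnerProductSpace.norm_rankOne]

section Complete

variable [CompleteSpace H]

theorem inner_crossCov {ξ η : Ω → H} (hξ : MemLp ξ 2 P) (hη : MemLp η 2 P) (h f : H) :
    (inner ℝ (crossCov P ξ η h) f : ℝ) = ∫ ω, (inner ℝ (ξ ω) h : ℝ) * inner ℝ (η ω) f ∂P := by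
  have hint : Integrable (fun ω => (inner ℝ (ξ ω) h : ℝ) • η ω) P :=
    ((ContinuousLinearMap.apply ℝ H h).integrable_comp (integrable_rankOne hξ hη))
  rw [crossCov_apply hξ hη, real_inner_comm, ← innerSL_apply_apply ℝ f,
    ← ContinuousLinearMap.integral_comp_comm _ hint]
  refine integral_congr_ae (Eventually.of_forall fun ω => ?_)
  simp [real_inner_comm]

/-- The compact operators form a closed convex set containing the rank-one operators, and an
expectation stays in such a set. -/
theorem isCompactOperator_crossCov [IsProbabilityMeasure P] {ξ η : Ω → H} (hξ : MemLp ξ 2 P)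
    (hη : MemLp η 2 P) : IsCompactOperator (crossCov P ξ η) := by
  have hclosed : IsClosed {T : H →L[ℝ] H | IsCompactOperator T} :=
    isClosed_setOfPred_isCompactOperator
  refine Convex.integral_mem (s := {T : H →L[ℝ] H | IsCompactOperator T}) ?_ hclosed
    (Eventually.of_forall fun ω => ?_) (integrable_rankOne hξ hη)
  · intro S hS T hT a b _ _ _
    exact (IsCompactOperator.smul hS a).add (IsCompactOperator.smul hT b)
  · have h1 : IsCompactOperator (innerSL ℝ (ξ ω)) :=
      isCompactOperator_of_locallyCompactSpace_dom (innerSL ℝ (ξ ω))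
    exact h1.clm_comp (ContinuousLinearMap.toSpanSingleton ℝ (η ω))

theorem isSymmetric_comp_adjoint (A : H →L[ℝ] H) :
    ((A ∘L ContinuousLinearMap.adjoint A : H →L[ℝ] H) : H →ₗ[ℝ] H).IsSymmetric := fun x y => by
  simp [← ContinuousLinearMap.adjoint_inner_right A, ← ContinuousLinearMap.adjoint_inner_left A]

theorem inner_comp_adjoint_self_nonneg (A : H →L[ℝ] H) (x : H) :
    0 ≤ (inner ℝ ((A ∘L ContinuousLinearMap.adjoint A) x) x : ℝ) := by
  rw [ContinuousLinearMap.comp_apply, ← ContinuousLinearMap.adjoint_inner_right]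
  exact real_inner_self_nonneg

/-- The orthogonal complements of the two ranges are `ker (A A*)` and `ker A*`, which coincide. -/
theorem closedRange_comp_adjoint (A : H →L[ℝ] H) :
    closedRange (A ∘L ContinuousLinearMap.adjoint A) = closedRange A := by
  unfold closedRange
  rw [← Submodule.orthogonal_orthogonal_eq_closure, ← Submodule.orthogonal_orthogonal_eq_closure]
  congr 1
  have h1 := ContinuousLinearMap.orthogonal_range (A ∘L ContinuousLinearMap.adjoint A)
  have h2 := ContinuousLinearMap.orthogonal_range A
  have h3 := ContinuousLinearMap.ker_self_comp_adjoint A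
  rw [ContinuousLinearMap.adjoint_comp, ContinuousLinearMap.adjoint_adjoint, h3, ← h2] at h1
  exact h1

/-- From `B B* - A A* = (B - A) B* + A (B - A)*`. -/
theorem norm_comp_adjoint_sub_le (A B : H →L[ℝ] H) :
    ‖B ∘L ContinuousLinearMap.adjoint B - A ∘L ContinuousLinearMap.adjoint A‖ ≤
      ‖B - A‖ * (2 * ‖A‖ + ‖B - A‖) := by
  have h : B ∘L ContinuousLinearMap.adjoint B - A ∘L ContinuousLinearMap.adjoint A =
      (B - A) ∘L ContinuousLinearMap.adjoint B + A ∘L ContinuousLinearMap.adjoint (B - A) := by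
    rw [map_sub, ContinuousLinearMap.sub_comp, ContinuousLinearMap.comp_sub]
    abel
  have hB : ‖B‖ ≤ ‖B - A‖ + ‖A‖ := by simpa using norm_add_le (B - A) A
  rw [h]
  refine (norm_add_le _ _).trans ?_
  have h1 := ContinuousLinearMap.opNorm_comp_le (B - A) (ContinuousLinearMap.adjoint B)
  have h2 := ContinuousLinearMap.opNorm_comp_le A (ContinuousLinearMap.adjoint (B - A))
  rw [LinearIsometryEquiv.norm_map] at h1 h2
  nlinarith [norm_nonneg (B - A), norm_nonneg A]

end Complete

namespace IsNoisyMeasurement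

variable [MeasurableSpace H] {𝕋 : Set ℤ} {ξ e ζ : ℤ → Ω → H}

theorem natCast_mem (hm : IsNoisyMeasurement P 𝕋 ξ e ζ) (n : ℕ) : (n : ℤ) ∈ 𝕋 := by
  rcases hm.times with h | h <;> simp [h]

theorem natCast_add_one_mem (hm : IsNoisyMeasurement P 𝕋 ξ e ζ) (n : ℕ) : (n : ℤ) + 1 ∈ 𝕋 := by
  exact_mod_cast hm.natCast_mem (n + 1)

theorem measurable_observed [BorelSpace H] [TopologicalSpace.SeparableSpace H]
    (hm : IsNoisyMeasurement P 𝕋 ξ e ζ) {t : ℤ} (ht : t ∈ 𝕋) : Measurable (ζ t) := by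
  rw [hm.observed t ht]
  have : SecondCountableTopology H := UniformSpace.secondCountable_of_separable H
  exact (hm.signal.measurable t ht).add (hm.noise.measurable t ht)

theorem sigmaOn_le [BorelSpace H] [TopologicalSpace.SeparableSpace H]
    (hm : IsNoisyMeasurement P 𝕋 ξ e ζ) {I : Set ℤ} (hI : I ⊆ 𝕋) :
    sigmaOn ζ I ≤ (inferInstance : MeasurableSpace Ω) :=
  iSup₂_le fun _ ht => (hm.measurable_observed (hI ht)).comap_le

theorem memLp_signal_zero (hm : IsNoisyMeasurement P 𝕋 ξ e ζ) : MemLp (ξ 0) 2 P :=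
  hm.signal.memLp 0 (by simpa using hm.natCast_mem 0)

variable [CompleteSpace H]

theorem isCompactOperator_opS [IsProbabilityMeasure P] (hm : IsNoisyMeasurement P 𝕋 ξ e ζ) :
    IsCompactOperator (opS P ξ) :=
  (isCompactOperator_crossCov hm.memLp_signal_zero
    (hm.signal.memLp _ (hm.natCast_mem 1))).comp_clm _

/-- The observations have the lag-one autocovariance operator of the signal. -/
theorem integral_inner_mul_inner (hm : IsNoisyMeasurement P 𝕋 ξ e ζ)
    (horth : ∀ t ∈ 𝕋, ∀ s ∈ 𝕋, StronglyOrthogonal P (e t) (ξ s)) (t : ℕ) (h f : H) :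
    ∫ ω, (inner ℝ (ζ t ω) h : ℝ) * inner ℝ (ζ ((t : ℤ) + 1) ω) f ∂P =
      inner ℝ (autocov P ξ 1 h) f := by
  have ht := hm.natCast_mem t
  have ht1 := hm.natCast_add_one_mem t
  have hξ := hm.signal.memLp _ ht
  have hξ1 := hm.signal.memLp _ ht1
  have he := hm.noise.memLp _ ht
  have he1 := hm.noise.memLp _ ht1
  have hint : ∀ {X Y : Ω → H}, MemLp X 2 P → MemLp Y 2 P →
      Integrable (fun ω => (inner ℝ (X ω) h : ℝ) * inner ℝ (Y ω) f) P := fun hX hY =>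
    (hX.inner_const h).integrable_mul (hY.inner_const f)
  have hshift : autocov P ξ 1 = crossCov P (ξ t) (ξ ((t : ℤ) + 1)) := by
    have := hm.signal.shift 0 (by simpa using hm.natCast_mem 0) 1
      (by simpa using hm.natCast_mem 1) t
    rw [zero_add, add_comm (1 : ℤ)] at this
    simpa [autocov] using this.symm
  rw [hshift, inner_crossCov hξ hξ1]
  have hz1 : ∫ ω, (inner ℝ (ξ t ω) h : ℝ) * inner ℝ (e ((t : ℤ) + 1) ω) f ∂P = 0 := by
    rw [← horth _ ht1 _ ht f h]
    refine integral_congr_ae (Eventually.of_forall fun ω => ?_)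
    simp only [real_inner_comm, mul_comm]
  have hz2 : ∫ ω, (inner ℝ (e t ω) h : ℝ) * inner ℝ (ξ ((t : ℤ) + 1) ω) f ∂P = 0 := by
    rw [← horth _ ht _ ht1 h f]
    refine integral_congr_ae (Eventually.of_forall fun ω => ?_)
    simp only [real_inner_comm]
  -- This is where lag one matters: the noise is orthogonal only at distinct times, and at lag zero
  -- its covariance would remain.
  have hz3 : ∫ ω, (inner ℝ (e t ω) h : ℝ) * inner ℝ (e ((t : ℤ) + 1) ω) f ∂P = 0 := by
    rw [← hm.noise.orthogonal _ ht _ ht1 (by simp) h f]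
    refine integral_congr_ae (Eventually.of_forall fun ω => ?_)
    simp only [real_inner_comm]
  have hexp : ∀ ω, (inner ℝ (ζ t ω) h : ℝ) * inner ℝ (ζ ((t : ℤ) + 1) ω) f =
      ((inner ℝ (ξ t ω) h : ℝ) * inner ℝ (ξ ((t : ℤ) + 1) ω) f +
        (inner ℝ (ξ t ω) h : ℝ) * inner ℝ (e ((t : ℤ) + 1) ω) f) +
      ((inner ℝ (e t ω) h : ℝ) * inner ℝ (ξ ((t : ℤ) + 1) ω) f +
        (inner ℝ (e t ω) h : ℝ) * inner ℝ (e ((t : ℤ) + 1) ω) f) := fun ω => by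
    rw [hm.observed _ ht, hm.observed _ ht1, Pi.add_apply, Pi.add_apply, inner_add_left,
      inner_add_left]
    ring
  simp_rw [hexp]
  have j1 : Integrable (fun ω => (inner ℝ (ξ t ω) h : ℝ) * inner ℝ (ξ ((t : ℤ) + 1) ω) f +
        (inner ℝ (ξ t ω) h : ℝ) * inner ℝ (e ((t : ℤ) + 1) ω) f) P :=
    (hint hξ hξ1).add (hint hξ he1)
  have j2 : Integrable (fun ω => (inner ℝ (e t ω) h : ℝ) * inner ℝ (ξ ((t : ℤ) + 1) ω) f +
        (inner ℝ (e t ω) h : ℝ) * inner ℝ (e ((t : ℤ) + 1) ω) f) P :=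
    (hint he hξ1).add (hint he he1)
  rw [integral_add j1 j2, integral_add (hint hξ hξ1) (hint hξ he1),
    integral_add (hint he hξ1) (hint he he1), hz1, hz2, hz3]
  ring

end IsNoisyMeasurement

end Model

/-! ### Mean-square error of the lag-one estimator and its transfer to `Ŝ`. -/

section Estimator

variable {H : Type u} [NormedAddCommGroup H] [InnerProductSpace ℝ H]
  {Ω : Type v} [MeasurableSpace Ω] {P : Measure Ω}
  {𝕋 : Set ℤ} {ξ e ζ : ℤ → Ω → H}

theorem memLp_inner_mul_inner {X Y : Ω → H} (hX : MemLp X 4 P) (hY : MemLp Y 4 P) (h f : H) :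
    MemLp (fun ω => (inner ℝ (X ω) h : ℝ) * inner ℝ (Y ω) f) 2 P := by
  have : ENNReal.HolderTriple 4 4 2 := ⟨by
    rw [show (4 : ℝ≥0∞) = 2 * 2 by norm_num, ENNReal.mul_inv (by simp) (by simp), ← two_mul,
      ← mul_assoc, ENNReal.mul_inv_cancel (by simp) (by simp), one_mul]⟩
  exact (hY.inner_const f).mul' (hX.inner_const h)

theorem measurable_sigmaOn_inner {Ω : Type v} [MeasurableSpace H] [BorelSpace H]
    {ζ : ℤ → Ω → H} {I : Set ℤ} {t : ℤ} (ht : t ∈ I) (h : H) :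
    Measurable[sigmaOn ζ I] fun ω => (inner ℝ (ζ t ω) h : ℝ) := by
  have h1 : Measurable[sigmaOn ζ I] (ζ t) :=
    (comap_measurable (ζ t)).mono (le_iSup₂_of_le t ht le_rfl) le_rfl
  have h2 : (fun ω => (inner ℝ (ζ t ω) h : ℝ)) = innerSL ℝ h ∘ ζ t :=
    funext fun ω => real_inner_comm _ _
  rw [h2]
  exact (innerSL ℝ h).continuous.measurable.comp h1

theorem hsNorm_sq_eq_tsum_inner [CompleteSpace H] {ι : Type*} (b : HilbertBasis ι ℝ H) (A : H →L[ℝ] H) :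
    hsNorm A ^ 2 = ∑' j, ∑' i, ‖(inner ℝ (b i) (A (b j)) : ℝ)‖ₑ ^ 2 := by
  rw [hsNorm_sq b]
  exact tsum_congr fun j => (tsum_enorm_inner_sq b _).symm

variable [TopologicalSpace.SeparableSpace H] [MeasurableSpace H] [BorelSpace H]

theorem IsNoisyMeasurement.measurable_inner_hatR_sub (hm : IsNoisyMeasurement P 𝕋 ξ e ζ) (n : ℕ)
    (A : H →L[ℝ] H) (h f : H) :
    Measurable fun ω => (inner ℝ f ((hatR ζ n ω - A) h) : ℝ) := by
  have : SecondCountableTopology H := UniformSpace.secondCountable_of_separable H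
  have hζ : ∀ t : ℕ, Measurable (ζ t) := fun t => hm.measurable_observed (hm.natCast_mem t)
  have hζ1 : ∀ t : ℕ, Measurable (ζ ((t : ℤ) + 1)) := fun t =>
    hm.measurable_observed (hm.natCast_add_one_mem t)
  have heq : ∀ ω, (inner ℝ f ((hatR ζ n ω - A) h) : ℝ) =
      ((n : ℝ) - 1)⁻¹ * (∑ t ∈ Finset.Ico 1 n,
        (inner ℝ (ζ t ω) h : ℝ) * inner ℝ f (ζ ((t : ℤ) + 1) ω)) - inner ℝ f (A h) := fun ω => by
    rw [sub_apply, inner_sub_right, hatR, smul_apply, inner_smul_right,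
      sum_apply, inner_sum]
    congr 2
    refine Finset.sum_congr rfl fun t _ => ?_
    rw [InnerProductSpace.rankOne_apply, inner_smul_right]
  simp_rw [heq]
  exact ((Finset.measurable_fun_sum _ fun t _ =>
    ((hζ t).inner measurable_const).mul (measurable_const.inner (hζ1 t))).const_mul _).sub_const _

variable [CompleteSpace H]

theorem IsNoisyMeasurement.measurable_hsNorm_hatR_sub_sq (hm : IsNoisyMeasurement P 𝕋 ξ e ζ) (n : ℕ)
    (A : H →L[ℝ] H) : Measurable fun ω => hsNorm (hatR ζ n ω - A) ^ 2 := by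
  have : Countable (basisIndex H) := countable_of_hilbertBasis (someBasis H)
  simp_rw [hsNorm_sq_eq_tsum_inner (someBasis H)]
  exact Measurable.tsum fun j => Measurable.tsum fun i =>
    (hm.measurable_inner_hatR_sub n A _ _).enorm.pow_const 2

variable [IsProbabilityMeasure P]

/-- The second moment of a coordinate of the estimation error of the lag-one autocovariance. -/
theorem IsNoisyMeasurement.integral_inner_hatR_sub_sq_le (hm : IsNoisyMeasurement P 𝕋 ξ e ζ)
    (hψ : ∑' k : ℕ, psiCoeff P 𝕋 ζ (k + 1) ≠ ∞) (h4 : ∀ t ∈ 𝕋, MemLp (ζ t) 4 P)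
    (horth : ∀ t ∈ 𝕋, ∀ s ∈ 𝕋, StronglyOrthogonal P (e t) (ξ s)) {n : ℕ} (hn : 2 ≤ n) (h f : H) :
    ∫⁻ ω, ‖(inner ℝ f ((hatR ζ n ω - autocov P ξ 1) h) : ℝ)‖ₑ ^ 2 ∂P ≤
      ENNReal.ofReal ((((n : ℝ) - 1)⁻¹) ^ 2 *
        (2 * (2 + ∑' k : ℕ, (psiCoeff P 𝕋 ζ (k + 1)).toReal))) *
      ∑ t ∈ Finset.Ico 1 n, ∫⁻ ω, ‖(inner ℝ (ζ t ω) h : ℝ)‖ₑ ^ 2 *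
        ‖(inner ℝ (ζ ((t : ℤ) + 1) ω) f : ℝ)‖ₑ ^ 2 ∂P := by
  set p : ℕ → ℝ := fun k => (psiCoeff P 𝕋 ζ (k + 1)).toReal with hp
  have hpne : ∀ k, psiCoeff P 𝕋 ζ (k + 1) ≠ ∞ := fun k => ENNReal.ne_top_of_tsum_ne_top hψ k
  have hpsum : Summable p := ENNReal.summable_toReal hψ
  -- `x t` involves times `t` and `t + 1`, so at lags 0 and 1 the variables share observations and
  -- get the trivial weight 1. At lag `k + 2` the observations are `k + 1` apart, which `p k`
  -- measures.
  let c : ℕ → ℝ := fun k => if k < 2 then 1 else p (k - 2)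
  have hc0 : ∀ k, 0 ≤ c k := fun k => by
    simp only [c]
    split_ifs
    · exact zero_le_one
    · exact ENNReal.toReal_nonneg
  have hcs : Summable c := by
    rw [← summable_nat_add_iff 2]
    simpa [c] using hpsum
  have hct : ∑' k, c k = 2 + ∑' k, p k := by
    rw [← hcs.sum_add_tsum_nat_add 2]
    simp [c, Finset.sum_range_succ]
    norm_num
  set x : ℕ → Ω → ℝ := fun t ω => (inner ℝ (ζ t ω) h : ℝ) * inner ℝ (ζ ((t : ℤ) + 1) ω) f with hx
  have hx2 : ∀ t, MemLp (x t) 2 P := fun t =>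
    memLp_inner_mul_inner (h4 _ (hm.natCast_mem t)) (h4 _ (hm.natCast_add_one_mem t)) h f
  set r : ℝ := inner ℝ (autocov P ξ 1 h) f with hr
  have hxr : ∀ t, ∫ ω, x t ω ∂P = r := fun t => hm.integral_inner_mul_inner horth t h f
  have hcov : ∀ s t : ℕ, s ≤ t → ∫ ω, x s ω * x t ω ∂P - r ^ 2 ≤
      c (t - s) * ((∫ ω, x s ω ^ 2 ∂P + ∫ ω, x t ω ^ 2 ∂P) / 2) := fun s t hst => by
    by_cases hlt : t - s < 2
    · have h1 := integral_mul_le_half_add (hx2 s) (hx2 t)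
      simp only [c, hlt, if_true, one_mul]
      nlinarith [sq_nonneg r]
    · obtain ⟨k, rfl⟩ : ∃ k, t = s + 2 + k := ⟨t - s - 2, by omega⟩
      have hk : s + 2 + k - s - 2 = k := by omega
      simp only [c, hlt, if_false, hk, hp]
      let A : Set ℤ := {u | u ∈ 𝕋 ∧ u ≤ (s : ℤ) + 1}
      let B : Set ℤ := {u | u ∈ 𝕋 ∧ (s : ℤ) + 1 + (k + 1 : ℕ) ≤ u}
      have hA1 : (s : ℤ) ∈ A := ⟨hm.natCast_mem s, by omega⟩
      have hA2 : (s : ℤ) + 1 ∈ A := ⟨hm.natCast_add_one_mem s, le_rfl⟩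
      have hB1 : ((s + 2 + k : ℕ) : ℤ) ∈ B := ⟨hm.natCast_mem _, by push_cast; omega⟩
      have hB2 : ((s + 2 + k : ℕ) : ℤ) + 1 ∈ B := ⟨hm.natCast_add_one_mem _, by push_cast; omega⟩
      have hdep : psiDep P (sigmaOn ζ A) (sigmaOn ζ B) ≤ psiCoeff P 𝕋 ζ (k + 1) :=
        le_iSup₂_of_le (f := fun (t : ℤ) (_ : t ∈ 𝕋) =>
          psiDep P (sigmaOn ζ {u | u ∈ 𝕋 ∧ u ≤ t})
            (sigmaOn ζ {u | u ∈ 𝕋 ∧ t + (k + 1 : ℕ) ≤ u}))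
          ((s : ℤ) + 1) (hm.natCast_add_one_mem s) le_rfl
      have h1 := integral_mul_sub_le_psiDep (hm.sigmaOn_le fun u (hu : u ∈ A) => hu.1)
        (hm.sigmaOn_le fun u (hu : u ∈ B) => hu.1) hdep (hpne k) (X := x s) (Y := x (s + 2 + k))
        ((measurable_sigmaOn_inner hA1 h).mul (measurable_sigmaOn_inner hA2 f))
        ((measurable_sigmaOn_inner hB1 h).mul (measurable_sigmaOn_inner hB2 f))
        (hx2 _) (hx2 _)
      rwa [hxr, hxr, ← sq] at h1
  have key := integral_sum_sub_sq_le hc0 hcs (Finset.Ico 1 n) (fun t _ => hx2 t)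
    (fun t _ => hxr t) (fun s _ t _ hst => hcov s t hst)
  have hn1 : (0 : ℝ) < (n : ℝ) - 1 := by
    have : (2 : ℝ) ≤ n := by exact_mod_cast hn
    linarith
  have hcoord : ∀ ω, (inner ℝ f ((hatR ζ n ω - autocov P ξ 1) h) : ℝ) =
      ((n : ℝ) - 1)⁻¹ * ∑ t ∈ Finset.Ico 1 n, (x t ω - r) := fun ω => by
    have hcard : ((Finset.Ico 1 n).card : ℝ) = (n : ℝ) - 1 := by
      rw [Nat.card_Ico, Nat.cast_sub (by omega), Nat.cast_one]
    rw [Finset.sum_sub_distrib, Finset.sum_const, nsmul_eq_mul, hcard, mul_sub,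
      inv_mul_cancel_left₀ hn1.ne', sub_apply, inner_sub_right, hr,
      real_inner_comm f (autocov P ξ 1 h)]
    congr 1
    rw [hatR, smul_apply, inner_smul_right, sum_apply,
      inner_sum]
    congr 1
    refine Finset.sum_congr rfl fun t _ => ?_
    rw [InnerProductSpace.rankOne_apply, inner_smul_right, real_inner_comm _ f]
  have hsum2 : MemLp (fun ω => ∑ t ∈ Finset.Ico 1 n, (x t ω - r)) 2 P :=
    memLp_finsetSum _ fun t _ => (hx2 t).sub (memLp_const r)
  have hsq : ∀ y : ℝ, ‖y‖ₑ ^ 2 = ENNReal.ofReal (y ^ 2) := fun y => by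
    rw [← ofReal_norm, ← ENNReal.ofReal_pow (norm_nonneg _), Real.norm_eq_abs, sq_abs]
  have hv : ∀ t : ℕ, ∫⁻ ω, ‖(inner ℝ (ζ t ω) h : ℝ)‖ₑ ^ 2 *
      ‖(inner ℝ (ζ ((t : ℤ) + 1) ω) f : ℝ)‖ₑ ^ 2 ∂P = ENNReal.ofReal (∫ ω, x t ω ^ 2 ∂P) :=
    fun t => by
      rw [ofReal_integral_eq_lintegral_ofReal (hx2 t).integrable_sq
        (Eventually.of_forall fun ω => sq_nonneg _)]
      refine lintegral_congr fun ω => ?_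
      rw [← mul_pow, ← enorm_mul, hsq]
  rw [lintegral_congr fun ω => by rw [hcoord, hsq, mul_pow],
    ← ofReal_integral_eq_lintegral_ofReal (hsum2.integrable_sq.const_mul _)
      (Eventually.of_forall fun ω => by positivity), integral_const_mul]
  simp_rw [hv]
  rw [← ENNReal.ofReal_sum_of_nonneg fun t _ => integral_nonneg fun ω => sq_nonneg _,
    ← ENNReal.ofReal_mul (mul_nonneg (sq_nonneg _) (by
      have : 0 ≤ ∑' k, p k := tsum_nonneg fun k => ENNReal.toReal_nonneg
      positivity))]
  refine ENNReal.ofReal_le_ofReal ?_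
  rw [mul_assoc]
  rw [hct] at key
  exact mul_le_mul_of_nonneg_left key (sq_nonneg _)

/-- The estimation error of the lag-one autocovariance in mean square. -/
theorem IsNoisyMeasurement.exists_lintegral_hsNorm_sq_le (hm : IsNoisyMeasurement P 𝕋 ξ e ζ)
    (hs : IsStrictlyStationary P 𝕋 ζ)
    (hψ : ∑' k : ℕ, psiCoeff P 𝕋 ζ (k + 1) ≠ ∞) (h4 : ∀ t ∈ 𝕋, MemLp (ζ t) 4 P)
    (horth : ∀ t ∈ 𝕋, ∀ s ∈ 𝕋, StronglyOrthogonal P (e t) (ξ s)) :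
    ∃ L : ℝ≥0, ∀ n : ℕ, 2 ≤ n →
      ∫⁻ ω, hsNorm (hatR ζ n ω - autocov P ξ 1) ^ 2 ∂P ≤ ENNReal.ofReal (L / n) := by
  have : Countable (basisIndex H) := countable_of_hilbertBasis (someBasis H)
  set b := someBasis H
  set C : ℝ := 2 * (2 + ∑' k : ℕ, (psiCoeff P 𝕋 ζ (k + 1)).toReal) with hC
  have hC0 : 0 ≤ C := by
    have : 0 ≤ ∑' k : ℕ, (psiCoeff P 𝕋 ζ (k + 1)).toReal :=
      tsum_nonneg fun k => ENNReal.toReal_nonneg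
    positivity
  have h0 : (0 : ℤ) ∈ 𝕋 := by simpa using hm.natCast_mem 0
  have hζ : ∀ t : ℕ, Measurable (ζ t) := fun t => hm.measurable_observed (hm.natCast_mem t)
  have hζ1 : ∀ t : ℕ, Measurable (ζ ((t : ℤ) + 1)) := fun t =>
    hm.measurable_observed (hm.natCast_add_one_mem t)
  set m : ℝ≥0∞ := ∫⁻ ω, ‖ζ 0 ω‖ₑ ^ 4 ∂P with hmdef
  have hmne : m ≠ ∞ := by
    have := lintegral_rpow_enorm_lt_top_of_eLpNorm_lt_top (p := 4) (by norm_num) (by norm_num)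
      (h4 0 h0).2
    have h44 : (4 : ℝ≥0∞).toReal = ((4 : ℕ) : ℝ) := by norm_num
    simp_rw [h44, ENNReal.rpow_natCast] at this
    exact this.ne
  have hmom : ∀ t : ℕ, ∫⁻ ω, ‖ζ t ω‖ₑ ^ 4 ∂P = m := fun t =>
    hs.lintegral_enorm_pow (fun t ht => hm.measurable_observed ht) h0 t (hm.natCast_mem t) 4
  have hmom1 : ∀ t : ℕ, ∫⁻ ω, ‖ζ ((t : ℤ) + 1) ω‖ₑ ^ 4 ∂P = m := fun t => by
    have := hmom (t + 1)
    push_cast at this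
    exact this
  have hprod : ∀ t : ℕ, ∫⁻ ω, ‖ζ t ω‖ₑ ^ 2 * ‖ζ ((t : ℤ) + 1) ω‖ₑ ^ 2 ∂P ≤ 2 * m := fun t => by
    calc ∫⁻ ω, ‖ζ t ω‖ₑ ^ 2 * ‖ζ ((t : ℤ) + 1) ω‖ₑ ^ 2 ∂P
        ≤ ∫⁻ ω, ‖ζ t ω‖ₑ ^ 4 + ‖ζ ((t : ℤ) + 1) ω‖ₑ ^ 4 ∂P := by
          refine lintegral_mono fun ω => ?_
          have hab : ∀ a b : ℝ≥0∞, a ^ 2 * b ^ 2 ≤ a ^ 4 + b ^ 4 := fun a b => by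
            rcases le_total a b with hab | hab
            · calc a ^ 2 * b ^ 2 ≤ b ^ 2 * b ^ 2 := by gcongr
                _ = b ^ 4 := by ring
                _ ≤ _ := le_add_self
            · calc a ^ 2 * b ^ 2 ≤ a ^ 2 * a ^ 2 := by gcongr
                _ = a ^ 4 := by ring
                _ ≤ _ := le_self_add
          exact hab _ _
      _ = 2 * m := by
          rw [lintegral_add_left ((hζ t).enorm.pow_const 4), hmom, hmom1, two_mul]
  -- Parseval in both factors under the integral: the coordinatewise variance bounds have a finite
  -- total even in infinite dimension.
  have hcoord : ∀ (t : ℕ), ∑' j, ∑' i, ∫⁻ ω, ‖(inner ℝ (ζ t ω) (b j) : ℝ)‖ₑ ^ 2 *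
      ‖(inner ℝ (ζ ((t : ℤ) + 1) ω) (b i) : ℝ)‖ₑ ^ 2 ∂P =
      ∫⁻ ω, ‖ζ t ω‖ₑ ^ 2 * ‖ζ ((t : ℤ) + 1) ω‖ₑ ^ 2 ∂P := fun t => by
    have hmeas : ∀ j i, Measurable fun ω => ‖(inner ℝ (ζ t ω) (b j) : ℝ)‖ₑ ^ 2 *
        ‖(inner ℝ (ζ ((t : ℤ) + 1) ω) (b i) : ℝ)‖ₑ ^ 2 := fun j i =>
      (((hζ t).inner_const).enorm.pow_const 2).mul (((hζ1 t).inner_const).enorm.pow_const 2)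
    rw [tsum_congr fun j => (lintegral_tsum fun i => (hmeas j i).aemeasurable).symm,
      ← lintegral_tsum fun j => (Measurable.tsum fun i => hmeas j i).aemeasurable]
    refine lintegral_congr fun ω => ?_
    simp_rw [ENNReal.tsum_mul_left, ENNReal.tsum_mul_right, fun (x : H) i => real_inner_comm (b i) x]
    rw [tsum_enorm_inner_sq b, tsum_enorm_inner_sq b]
  -- The bound obtained is `2 C m / (n - 1)`, and `n ≤ 2 (n - 1)` for `n ≥ 2`.
  refine ⟨Real.toNNReal (4 * C * m.toReal), fun n hn => ?_⟩
  have hn2 : (2 : ℝ) ≤ n := by exact_mod_cast hn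
  have hn1 : (0 : ℝ) < (n : ℝ) - 1 := by linarith
  have hcard : (((Finset.Ico 1 n).card : ℕ) : ℝ≥0∞) = ENNReal.ofReal ((n : ℝ) - 1) := by
    rw [Nat.card_Ico, ← ENNReal.ofReal_natCast, Nat.cast_sub (by omega), Nat.cast_one]
  calc ∫⁻ ω, hsNorm (hatR ζ n ω - autocov P ξ 1) ^ 2 ∂P
      = ∑' j, ∑' i, ∫⁻ ω,
          ‖(inner ℝ (b i) ((hatR ζ n ω - autocov P ξ 1) (b j)) : ℝ)‖ₑ ^ 2 ∂P := by
        simp_rw [hsNorm_sq_eq_tsum_inner b]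
        have hmeas : ∀ j i, Measurable fun ω =>
            ‖(inner ℝ (b i) ((hatR ζ n ω - autocov P ξ 1) (b j)) : ℝ)‖ₑ ^ 2 := fun j i =>
          (hm.measurable_inner_hatR_sub n _ _ _).enorm.pow_const 2
        rw [lintegral_tsum fun j => (Measurable.tsum fun i => hmeas j i).aemeasurable]
        exact tsum_congr fun j => lintegral_tsum fun i => (hmeas j i).aemeasurable
    _ ≤ ∑' j, ∑' i, ENNReal.ofReal ((((n : ℝ) - 1)⁻¹) ^ 2 * C) *
          ∑ t ∈ Finset.Ico 1 n, ∫⁻ ω, ‖(inner ℝ (ζ t ω) (b j) : ℝ)‖ₑ ^ 2 *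
            ‖(inner ℝ (ζ ((t : ℤ) + 1) ω) (b i) : ℝ)‖ₑ ^ 2 ∂P :=
        ENNReal.tsum_le_tsum fun j => ENNReal.tsum_le_tsum fun i =>
          hm.integral_inner_hatR_sub_sq_le hψ h4 horth hn _ _
    _ = ENNReal.ofReal ((((n : ℝ) - 1)⁻¹) ^ 2 * C) *
          ∑ t ∈ Finset.Ico 1 n, ∫⁻ ω, ‖ζ t ω‖ₑ ^ 2 * ‖ζ ((t : ℤ) + 1) ω‖ₑ ^ 2 ∂P := by
        simp_rw [ENNReal.tsum_mul_left]
        congr 1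
        rw [← Finset.sum_congr rfl fun t _ => hcoord t]
        rw [← Summable.tsum_finsetSum fun t _ => ENNReal.summable]
        refine tsum_congr fun j => ?_
        exact Summable.tsum_finsetSum fun t _ => ENNReal.summable
    _ ≤ ENNReal.ofReal ((((n : ℝ) - 1)⁻¹) ^ 2 * C) * ∑ t ∈ Finset.Ico 1 n, 2 * m := by
        gcongr with t
        exact hprod t
    _ = ENNReal.ofReal ((((n : ℝ) - 1)⁻¹) ^ 2 * C * (((n : ℝ) - 1) * (2 * m.toReal))) := by
        rw [Finset.sum_const, nsmul_eq_mul, hcard,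
          ENNReal.ofReal_mul (p := (((n : ℝ) - 1)⁻¹) ^ 2 * C) (by positivity),
          ENNReal.ofReal_mul hn1.le, ENNReal.ofReal_mul (p := 2) (by norm_num),
          ENNReal.ofReal_toReal hmne, ENNReal.ofReal_ofNat]
    _ ≤ _ := by
        refine ENNReal.ofReal_le_ofReal ?_
        have hm0 : 0 ≤ m.toReal := ENNReal.toReal_nonneg
        rw [Real.coe_toNNReal _ (by positivity)]
        have e1 : (((n : ℝ) - 1)⁻¹) ^ 2 * C * (((n : ℝ) - 1) * (2 * m.toReal)) =
            2 * C * m.toReal / ((n : ℝ) - 1) := by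
          field_simp
        rw [e1, div_le_div_iff₀ hn1 (by linarith)]
        have : 0 ≤ C * m.toReal := by positivity
        nlinarith

/-- Transfer of a perturbation bound for `S` to its estimator. -/
theorem IsNoisyMeasurement.isBigOInProb_of_perturbation (hm : IsNoisyMeasurement P 𝕋 ξ e ζ)
    (hs : IsStrictlyStationary P 𝕋 ζ)
    (hψ : ∑' k : ℕ, psiCoeff P 𝕋 ζ (k + 1) ≠ ∞) (h4 : ∀ t ∈ 𝕋, MemLp (ζ t) 4 P)
    (horth : ∀ t ∈ 𝕋, ∀ s ∈ 𝕋, StronglyOrthogonal P (e t) (ξ s))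
    {X : ℕ → Ω → ℝ≥0∞} {g : ℝ} (hg : 0 < g) {K : ℝ≥0}
    (hX : ∀ n ω, ‖hatS ζ n ω - opS P ξ‖ ≤ g →
      X n ω ≤ ENNReal.ofReal (K * ‖hatS ζ n ω - opS P ξ‖)) :
    IsBigOInProb P X (fun n => (n : ℝ) ^ (-(1 / 2) : ℝ)) := by
  obtain ⟨L, hL⟩ := hm.exists_lintegral_hsNorm_sq_le hs hψ h4 horth
  set R := autocov P ξ 1
  have hB : 0 < 2 * ‖R‖ + 1 := by positivity
  -- The bound 1 on the error of `R̂₁` makes the quadratic estimate for `Ŝ - S` linear with factor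
  -- `2 ‖R‖ + 1`; the second bound brings `Ŝ - S` within the radius `g`.
  refine isBigOInProb_of_lintegral_sq_le (D := fun n ω => hsNorm (hatR ζ n ω - R))
    (fun n => (hm.measurable_hsNorm_hatR_sub_sq n R).aemeasurable) hL
    (δ := min 1 (g / (2 * ‖R‖ + 1))) (lt_min one_pos (by positivity))
    (K := K * Real.toNNReal (2 * ‖R‖ + 1)) fun n ω hD => ?_
  set Δ := hatR ζ n ω - R with hΔ
  have h1 : ‖Δ‖ ≤ min 1 (g / (2 * ‖R‖ + 1)) := by
    have := (enorm_le_hsNorm Δ).trans hD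
    rw [← ofReal_norm] at this
    exact (ENNReal.ofReal_le_ofReal_iff (by positivity)).mp this
  have h2 : ‖hatS ζ n ω - opS P ξ‖ ≤ ‖Δ‖ * (2 * ‖R‖ + 1) := by
    refine (norm_comp_adjoint_sub_le R (hatR ζ n ω)).trans ?_
    have := h1.trans (min_le_left _ _)
    gcongr
  have h3 : ‖hatS ζ n ω - opS P ξ‖ ≤ g := by
    refine h2.trans ?_
    rw [← le_div_iff₀ hB]
    exact h1.trans (min_le_right _ _)
  refine (hX n ω h3).trans ?_
  calc ENNReal.ofReal (K * ‖hatS ζ n ω - opS P ξ‖)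
      ≤ ENNReal.ofReal (K * (2 * ‖R‖ + 1) * ‖Δ‖) := by
        refine ENNReal.ofReal_le_ofReal ?_
        rw [mul_assoc, mul_comm _ ‖Δ‖]
        gcongr
    _ = (K * Real.toNNReal (2 * ‖R‖ + 1) : ℝ≥0) * ‖Δ‖ₑ := by
        rw [ENNReal.ofReal_mul (by positivity), ENNReal.ofReal_mul NNReal.zero_le_coe,
          ENNReal.ofReal_coe_nnreal, ofReal_norm, ENNReal.coe_mul]
        rfl
    _ ≤ _ := by
        gcongr
        exact enorm_le_hsNorm Δ

end Estimator

/-! ### The metric on finite-dimensional subspaces. -/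

section Gap

variable {H : Type u} [NormedAddCommGroup H] [InnerProductSpace ℝ H]

/-- The gap metric on the finite-dimensional subspaces: the distance of `U` and `V` is the operator
norm of the difference of the orthogonal projections. -/
noncomputable abbrev gapMetric (H : Type u) [NormedAddCommGroup H] [InnerProductSpace ℝ H]
    [CompleteSpace H] : MetricSpace {V : Submodule ℝ H // FiniteDimensional ℝ V} :=
  MetricSpace.induced
    (fun V => haveI := V.2; V.1.starProjection)
    (fun U V h => by
      have := U.2
      have := V.2
      exact Subtype.ext (Submodule.starProjection_inj.mp h))
    inferInstance

theorem gapMetric_dist [CompleteSpace H] (U V : Submodule ℝ H) [hU : FiniteDimensional ℝ U]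
    [hV : FiniteDimensional ℝ V] :
    (gapMetric H).dist ⟨U, hU⟩ ⟨V, hV⟩ = ‖U.starProjection - V.starProjection‖ :=
  dist_eq_norm U.starProjection V.starProjection

end Gap

theorem IsBigOInProb.mono {Ω : Type v} [MeasurableSpace Ω] {P : Measure Ω} {X Y : ℕ → Ω → ℝ≥0∞}
    {a : ℕ → ℝ} (h : IsBigOInProb P Y a) (hXY : ∀ n ω, X n ω ≤ Y n ω) : IsBigOInProb P X a := by
  intro ε hε
  obtain ⟨C, N, hC⟩ := h ε hε
  exact ⟨C, N, fun n hn => (measure_mono fun ω hω => lt_of_lt_of_le hω (hXY n ω)).trans (hC n hn)⟩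

end HilbertSeries

/-! ### Assembly of the three rates. -/

open HilbertSeries in
theorem corollary2 {H : Type*} [NormedAddCommGroup H] [InnerProductSpace ℝ H] [CompleteSpace H]
    [TopologicalSpace.SeparableSpace H] [MeasurableSpace H] [BorelSpace H] :
    ∃ ρ : MetricSpace {V : Submodule ℝ H // FiniteDimensional ℝ V},
      ∀ {Ω : Type*} [MeasurableSpace Ω] (P : Measure Ω) [IsProbabilityMeasure P]
        (𝕋 : Set ℤ) (ξ e ζ : ℤ → Ω → H)
        (_ : IsNoisyMeasurement P 𝕋 ξ e ζ)
        -- (A1)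
        (_ : closedRange (autocov P ξ 1) = closedRange (autocov P ξ 0))
        -- (A2)
        (_ : IsStrictlyStationary P 𝕋 ζ)
        (_ : IsPsiMixing P 𝕋 ζ)
        (_ : ∑' k : ℕ, ((k + 1 : ℕ) : ℝ≥0∞) * psiCoeff P 𝕋 ζ (k + 1) ^ (1 / 2 : ℝ) < ∞)
        -- (A3)
        (_ : ∀ t ∈ 𝕋, MemLp (ζ t) 4 P)
        -- (A4)
        (_ : ∀ t ∈ 𝕋, ∀ s ∈ 𝕋, StronglyOrthogonal P (e t) (ξ s))
        -- the spectral representations of `S` and of `Ŝ`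
        (θ : ℕ → ℝ) (ψ : ℕ → H)
        (_ : IsNonzeroEigensystem (opS P ξ) θ ψ)
        (θhat : ℕ → Ω → ℕ → ℝ) (ψhat : ℕ → Ω → ℕ → H)
        (_ : ∀ n ω, IsEigenbasis (hatS ζ n ω) (θhat n ω) (ψhat n ω)),
        (∀ j ∈ indices (opRank (opS P ξ)),
          Module.finrank ℝ (eigenker (opS P ξ) (θ j)) = 1 →
          IsBigOInProb P
            (fun n ω => hsNorm ((eigenker (hatS ζ n ω) (θhat n ω j)).starProjection
              - (eigenker (opS P ξ) (θ j)).starProjection))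
            (fun n => (n : ℝ) ^ (-(1 / 2) : ℝ))) ∧
        (∀ d : ℕ, opRank (opS P ξ) = d →
          IsBigOInProb P
            (fun n ω => hsNorm ((leadingSpan (ψhat n ω) d).starProjection
              - (closedRange (autocov P ξ 0)).starProjection))
            (fun n => (n : ℝ) ^ (-(1 / 2) : ℝ))) ∧
        (∀ d : ℕ, opRank (opS P ξ) = d →
          ∃ hM : FiniteDimensional ℝ (closedRange (autocov P ξ 0)),
            IsBigOInProb P
              (fun n ω => ENNReal.ofReal
                (ρ.dist ⟨leadingSpan (ψhat n ω) d, inferInstance⟩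
                  ⟨closedRange (autocov P ξ 0), hM⟩))
              (fun n => (n : ℝ) ^ (-(1 / 2) : ℝ))) := by
  refine ⟨gapMetric H, ?_⟩
  intro Ω _ P _ 𝕋 ξ e ζ hm hA1 hs _ hψ h4 horth θ ψ hθ θhat ψhat hhat
  have hsum := tsum_ne_top_of_tsum_mul_rpow hψ
  have hsymm : (opS P ξ : H →ₗ[ℝ] H).IsSymmetric := isSymmetric_comp_adjoint _
  have hpos : ∀ x, 0 ≤ (inner ℝ (opS P ξ x) x : ℝ) := inner_comp_adjoint_self_nonneg _
  have hc := hm.isCompactOperator_opS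
  -- (A1) replaces `R₀` by `R₁`, whose closed range is that of `S = R₁ R₁*`; in finite rank this is
  -- the span of the eigenvectors, already closed.
  have hM : ∀ d : ℕ, opRank (opS P ξ) = d →
      closedRange (autocov P ξ 0) = leadingSpan ψ d := fun d hd => by
    rw [← hA1, ← closedRange_comp_adjoint]
    change (LinearMap.range (opS P ξ : H →ₗ[ℝ] H)).topologicalClosure = _
    rw [← hθ.leadingSpan_eq_range hd]
    exact Submodule.topologicalClosure_eq_self _
  have hii : ∀ d : ℕ, opRank (opS P ξ) = d →
      IsBigOInProb P
        (fun n ω => hsNorm ((leadingSpan (ψhat n ω) d).starProjection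
          - (closedRange (autocov P ξ 0)).starProjection))
        (fun n => (n : ℝ) ^ (-(1 / 2) : ℝ)) := fun d hd => by
    obtain ⟨g, hg, K, hK⟩ := hθ.exists_hsNorm_leadingSpan_le hsymm hpos hc hd
    refine hm.isBigOInProb_of_perturbation hs hsum h4 horth hg (K := K) fun n ω hn => ?_
    have hproj : (closedRange (autocov P ξ 0)).starProjection =
        (leadingSpan ψ d).starProjection := Submodule.starProjection_inj.mpr (hM d hd)
    rw [hproj]
    exact hK _ _ _ (hhat n ω) (isSymmetric_comp_adjoint _) hn
  refine ⟨fun j hj hone => ?_, hii, fun d hd => ?_⟩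
  · obtain ⟨g, hg, K, hK⟩ := hθ.exists_hsNorm_eigenker_le hsymm hpos hc hj hone
    exact hm.isBigOInProb_of_perturbation hs hsum h4 horth hg (K := K) fun n ω hn =>
      hK _ _ _ (hhat n ω) (isSymmetric_comp_adjoint _) hn
  · have hfin : FiniteDimensional ℝ (closedRange (autocov P ξ 0)) := hM d hd ▸ inferInstance
    refine ⟨hfin, (hii d hd).mono fun n ω => ?_⟩
    rw [gapMetric_dist, ofReal_norm]
    exact enorm_le_hsNorm _
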